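/- Let $\Bbbk$ be a field, let $G$ be a finite simple graph, and let $\pi=\{W_1,\dots,W_r\}$ be a clique partition of $G$, that is, the $W_i$ are pairwise disjoint (possibly empty) cliques of $G$ whose union is $V(G)$. Let $n_1,\dots,n_r$ be positive integers. The multi-clique-whiskered graph $H=G^{\pi}[n_1,\dots,n_r]$ is the graph on $V(G)\cup\{w_{i,k} : 1\le i\le r,\ 1\le k\le n_i\}$ with edge set $E(G)\cup\{\{x,w_{i,k}\} : 1\le i\le r,\ x\in W_i,\ 1\le k\le n_i\}$; the clique-whiskered graph $G^\pi$ is $G^\pi[1,\dots,1]$, with $w_i:=w_{i,1}$. Let $S=\Bbbk[V(H)]$ be the polynomial ring whose variables are the vertices of $H$, with its multigrading by monomials, let $\mathfrak m\subset S$ be the ideal generated by all variables, and let $J(H)\subset S$ be the cover ideal, generated by the monomials $\prod_{v\in C}v$ for the vertex covers $C$ of $H$. Fix a total order $<$ on $V(G)$ (for example, list the vertices of $W_1$, then those of $W_2$, and so on). Write $\mathbf w_i=w_{i,1}\cdots w_{i,n_i}$, $\mathbf z_C=\prod_{v\in C}v$ and $\mathbf x_\sigma=\prod_{x\in\sigma}x$.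 For $i\ge 0$ let $F_i$ be the multigraded free $S$-module with basis the symbols $\mathbf f(C;\sigma)$ of multidegree $\mathbf z_C\mathbf x_\sigma$, where $C$ is a minimal vertex cover of $H$ and $\sigma\subseteq V(G)\setminus C$ has exactly $i$ elements. Let $d_0:F_0\to J(H)$ be given by $d_0(\mathbf f(C;\varnothing))=\mathbf z_C$, and for $i>0$ let $d_i:F_i\to F_{i-1}$ be given by $$d_i(\mathbf f(C;\sigma))=\sum_{x\in\sigma}(-1)^{|\{y\in\sigma\,:\,y>x\}|}\Bigl[\mathbf w_{p(x)}\,\mathbf f\bigl((C\setminus\{w_{p(x),1},\dots,w_{p(x),n_{p(x)}}\})\cup\{x\};\,\sigma\setminus\{x\}\bigr)-x\,\mathbf f(C;\sigma\setminus\{x\})\Bigr],$$ where $p(x)$ is the index with $x\in W_{p(x)}$. Then $$\cdots\longrightarrow F_2\overset{d_2}{\longrightarrow}F_1\overset{d_1}{\longrightarrow}F_0\overset{d_0}{\longrightarrow}J(H)\longrightarrow 0$$ is a minimal multigraded free resolution of $J(H)$: every $F_i$ has finite rank, the sequence is exact, all maps preserve multidegrees, and $d_i(F_i)\subseteq\mathfrak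 m F_{i-1}$ for all $i\ge 1$. Moreover, this resolution is obtained from the one for $G^\pi$ by replacing each $w_i$ with $\mathbf w_i$. Precisely, there are bijections $\mathbf f(C;\sigma)\mapsto\mathbf f(\tilde C;\sigma)$ between the bases for $G^\pi$ and for $H$, where $\tilde C\cap V(G)=C\cap V(G)$ and $w_{i,k}\in\tilde C$ if and only if $w_i\in C$. With respect to these bases, the matrix entries of the $d_i$ for $i\ge1$, the values of $d_0$, and the multidegrees (as monomials) for $H$ are the images of those for $G^\pi$ under the substitution $x\mapsto x$ $(x\in V(G))$, $w_i\mapsto\mathbf w_i$. -/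

import Mathlib

/-! ### Multigraded augmented free sequences over a polynomial ring -/

/-- A sequence `⋯ → F₂ → F₁ → F₀ → J` of multigraded free modules over `k[X_s : s ∈ σ]` and linear
maps, ending in an ideal `J`. The module `F i` is the free module on the basis `ι i`, and the basis
element `b` sits in multidegree `deg i b`. The map `d i` goes from `F (i + 1)` to `F i`.
Nothing is required here; see `AugmentedFreeSequence.IsMinimalFreeResolution`. -/
structure AugmentedFreeSequence (k : Type*) [Field k] {σ : Type*} (J : Ideal (MvPolynomial σ k))
    where
  ι : ℕ → Type*
  deg : ∀ i, ι i → (σ →₀ ℕ)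
  d : ∀ i, (ι (i + 1) →₀ MvPolynomial σ k) →ₗ[MvPolynomial σ k] (ι i →₀ MvPolynomial σ k)
  aug : (ι 0 →₀ MvPolynomial σ k) →ₗ[MvPolynomial σ k] J

/-- An element `∑ p_b b` of the free module on `B`, whose basis element `b` has multidegree
`deg b`, is homogeneous of multidegree `m` if every monomial `X^e` of `p_b` satisfies
`e + deg b = m`. -/
def IsMultihomogeneous {k σ B : Type*} [Field k] (deg : B → (σ →₀ ℕ)) (m : σ →₀ ℕ)
    (x : B →₀ MvPolynomial σ k) : Prop :=
  ∀ b, ∀ e ∈ (x b).support, e + deg b = m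

/-- The sequence is a minimal multigraded free resolution of `J`: the free modules have finite
rank, the sequence `⋯ → F₁ → F₀ → J → 0` is exact, all maps preserve multidegrees, and
`d (F (i + 1)) ⊆ 𝔪 (F i)`, where `𝔪` is generated by all the variables. -/
structure AugmentedFreeSequence.IsMinimalFreeResolution {k : Type*} [Field k] {σ : Type*}
    {J : Ideal (MvPolynomial σ k)} (A : AugmentedFreeSequence k J) : Prop where
  finite : ∀ i, Finite (A.ι i)
  aug_surjective : Function.Surjective A.aug
  exact_zero : Function.Exact (A.d 0) A.aug
  exact_succ : ∀ i, Function.Exact (A.d (i + 1)) (A.d i)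
  aug_homogeneous : ∀ m x, IsMultihomogeneous (A.deg 0) m x →
    ∀ e ∈ (A.aug x : MvPolynomial σ k).support, e = m
  d_homogeneous : ∀ i m x, IsMultihomogeneous (A.deg (i + 1)) m x →
    IsMultihomogeneous (A.deg i) m (A.d i x)
  minimal : ∀ i x, A.d i x ∈
    Ideal.span (Set.range (MvPolynomial.X : σ → MvPolynomial σ k)) •
      (⊤ : Submodule (MvPolynomial σ k) (A.ι i →₀ MvPolynomial σ k))

/-- `B` is obtained from `A` by applying the substitution `φ` to all matrix entries (with respect
to the distinguished bases, matched by `e`), to the values of the augmentation on the basis, and to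
the multidegrees of the basis elements written as monomials. -/
structure AugmentedFreeSequence.IsSubstitution {k : Type*} [Field k] {σ τ : Type*}
    {I : Ideal (MvPolynomial σ k)} {J : Ideal (MvPolynomial τ k)}
    (φ : MvPolynomial σ k →ₐ[k] MvPolynomial τ k)
    (A : AugmentedFreeSequence k I) (B : AugmentedFreeSequence k J)
    (e : ∀ i, A.ι i ≃ B.ι i) : Prop where
  d_eq : ∀ i (b : A.ι (i + 1)) (c : A.ι i),
    B.d i (Finsupp.single (e (i + 1) b) 1) (e i c) = φ (A.d i (Finsupp.single b 1) c)
  aug_eq : ∀ b : A.ι 0, (B.aug (Finsupp.single (e 0 b) 1) : MvPolynomial τ k) =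
    φ (A.aug (Finsupp.single b 1) : MvPolynomial σ k)
  deg_eq : ∀ i (b : A.ι i),
    MvPolynomial.monomial (B.deg i (e i b)) (1 : k) = φ (MvPolynomial.monomial (A.deg i b) 1)

/-! ### Cover ideals -/

/-- `C` is a minimal vertex cover of `H`. -/
def IsMinimalVertexCover {W : Type*} (H : SimpleGraph W) (C : Finset W) : Prop :=
  Minimal (fun D : Finset W => H.IsVertexCover (D : Set W)) C

/-- The cover ideal of `H`, generated by the monomials `∏_{v ∈ C} X_v` for all vertex covers `C`. -/
noncomputable def coverIdeal (k : Type*) [Field k] {W : Type*} (H : SimpleGraph W) :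
    Ideal (MvPolynomial W k) :=
  Ideal.span {p | ∃ C : Finset W, H.IsVertexCover (C : Set W) ∧ p = ∏ v ∈ C, MvPolynomial.X v}

/-! ### Multi-clique-whiskered graphs -/

/-- A clique partition `{W_1, …, W_r}` of `G`, given by the map that sends each vertex to the index
of its block, so that `W_i = {v | index v = i}` is a clique. Empty blocks are allowed. -/
structure CliquePartition {V : Type*} (G : SimpleGraph V) (r : ℕ) where
  index : V → Fin r
  isClique : ∀ i, G.IsClique {v | index v = i}

/-- The vertices of `G^π[n_1, …, n_r]`: the vertices `x` of `G`, as `Sum.inl x`, and the new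
vertices `w_{i,k}`, as `Sum.inr ⟨i, k⟩`. -/
abbrev WhiskerVertex (V : Type*) {r : ℕ} (n : Fin r → ℕ+) :=
  V ⊕ (Σ i : Fin r, Fin (n i : ℕ))

/-- The multi-clique-whiskered graph `G^π[n_1, …, n_r]`: the new vertices `w_{i,1}, …, w_{i,n_i}`
are joined to all vertices of `W_i`. The clique-whiskered graph `G^π` is the case
`n_1 = ⋯ = n_r = 1`. -/
def multiCliqueWhiskered {V : Type*} {G : SimpleGraph V} {r : ℕ} (π : CliquePartition G r)
    (n : Fin r → ℕ+) : SimpleGraph (WhiskerVertex V n) where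
  Adj
    | Sum.inl u, Sum.inl v => G.Adj u v
    | Sum.inl u, Sum.inr w => π.index u = w.1
    | Sum.inr w, Sum.inl u => π.index u = w.1
    | Sum.inr _, Sum.inr _ => False
  symm := ⟨by
    rintro (u | w) (v | w') h
    · exact G.adj_symm h
    · exact h
    · exact h
    · exact h⟩
  loopless := ⟨by
    rintro (u | w) h
    · exact G.irrefl h
    · exact h⟩

/-- The set `{w_{i,1}, …, w_{i,n_i}}`. -/
def whiskers (V : Type*) [DecidableEq V] {r : ℕ} (n : Fin r → ℕ+) (i : Fin r) :
    Finset (WhiskerVertex V n) :=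
  Finset.univ.image fun k : Fin (n i : ℕ) => Sum.inr ⟨i, k⟩

/-- `V(G) \ C`. -/
def uncovered {V : Type*} [Fintype V] [DecidableEq V] {r : ℕ} {n : Fin r → ℕ+}
    (C : Finset (WhiskerVertex V n)) : Finset V :=
  Finset.univ.filter fun v => Sum.inl v ∉ C

/-- `(C \ {w_{i,1}, …, w_{i,n_i}}) ∪ {x}`, where `i` is the index of the block of `x`. -/
def swapCover {V : Type*} [DecidableEq V] {G : SimpleGraph V} {r : ℕ}
    (π : CliquePartition G r) {n : Fin r → ℕ+} (C : Finset (WhiskerVertex V n)) (x : V) :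
    Finset (WhiskerVertex V n) :=
  (C \ whiskers V n (π.index x)) ∪ {Sum.inl x}

/-- Every vertex of a minimal vertex cover has a neighbour outside of it. -/
theorem IsMinimalVertexCover.exists_adj_notMem {W : Type*} [DecidableEq W] {H : SimpleGraph W}
    {C : Finset W} (hC : IsMinimalVertexCover H C) {a : W} (ha : a ∈ C) :
    ∃ b, H.Adj a b ∧ b ∉ C := by
  by_contra! hcon
  have hcov : H.IsVertexCover ((C.erase a : Finset W) : Set W) := by
    intro u v huv
    rcases eq_or_ne u a with rfl | hu
    · exact Or.inr (Finset.mem_erase.2 ⟨huv.ne', hcon v huv⟩)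
    rcases eq_or_ne v a with rfl | hv
    · exact Or.inl (Finset.mem_erase.2 ⟨hu, hcon u huv.symm⟩)
    · exact (hC.prop huv).imp (fun h => Finset.mem_erase.2 ⟨hu, h⟩)
        fun h => Finset.mem_erase.2 ⟨hv, h⟩
  exact Finset.notMem_erase a C (hC.le_of_le hcov (Finset.erase_subset a C) ha)

/-- Swapping `x ∉ C` against the whiskers at its block keeps `C` a minimal vertex cover. -/
theorem isMinimalVertexCover_swapCover {V : Type*} [DecidableEq V] {G : SimpleGraph V} {r : ℕ}
    (π : CliquePartition G r) {n : Fin r → ℕ+} {C : Finset (WhiskerVertex V n)}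
    (hC : IsMinimalVertexCover (multiCliqueWhiskered π n) C) {x : V} (hx : Sum.inl x ∉ C) :
    IsMinimalVertexCover (multiCliqueWhiskered π n) (swapCover π C x) := by
  have hl : ∀ v : V, Sum.inl v ∈ swapCover π C x ↔ Sum.inl v ∈ C ∨ v = x := by
    simp [swapCover, whiskers, or_comm]
  have hr : ∀ w : (Σ i : Fin r, Fin (n i : ℕ)),
      Sum.inr w ∈ swapCover π C x ↔ Sum.inr w ∈ C ∧ w.1 ≠ π.index x := by
    rintro ⟨j, l⟩
    simp only [swapCover, whiskers, Finset.mem_union, Finset.mem_sdiff, Finset.mem_image,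
      Finset.mem_univ, true_and, Finset.mem_singleton, reduceCtorEq, or_false, ne_eq]
    refine and_congr_right fun _ => not_congr ⟨?_, ?_⟩
    · rintro ⟨m, hm⟩
      exact (congrArg Sigma.fst (Sum.inr.inj hm)).symm
    · rintro rfl
      exact ⟨l, rfl⟩
  have hblock : ∀ u, π.index u = π.index x → Sum.inl u ∈ swapCover π C x := by
    intro u hu
    rw [hl]
    by_contra! h
    have hadj : G.Adj u x := π.isClique (π.index x) hu rfl h.2
    exact (hC.prop (v := Sum.inl u) (w := Sum.inl x) hadj).elim h.1 hx
  have hcov : (multiCliqueWhiskered π n).IsVertexCover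
      ((swapCover π C x : Finset (WhiskerVertex V n)) : Set (WhiskerVertex V n)) := by
    rintro (u | w) (v | w') h
    · exact (hC.prop h).imp (fun h => (hl u).2 (Or.inl h)) fun h => (hl v).2 (Or.inl h)
    · by_cases hw : w'.1 = π.index x
      · exact Or.inl (hblock u (Eq.trans h hw))
      · exact (hC.prop h).imp (fun h => (hl u).2 (Or.inl h)) fun h => (hr w').2 ⟨h, hw⟩
    · by_cases hw : w.1 = π.index x
      · exact Or.inr (hblock v (Eq.trans h hw))
      · exact (hC.prop h).imp (fun h => (hr w).2 ⟨h, hw⟩) fun h => (hl v).2 (Or.inl h)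
    · exact h.elim
  refine ⟨hcov, fun D hD hDC a ha => ?_⟩
  have hout : ∀ w : (Σ i : Fin r, Fin (n i : ℕ)), Sum.inr w ∈ C → w.1 ≠ π.index x →
      ∃ u, π.index u = w.1 ∧ Sum.inl u ∉ D ∧ Sum.inl u ∉ C := by
    intro w hw hne
    obtain ⟨u | w', hadj, hu⟩ := hC.exists_adj_notMem hw
    · refine ⟨u, hadj, fun h => ?_, hu⟩
      rcases (hl u).1 (hDC h) with h | rfl
      · exact hu h
      · exact hne (Eq.symm hadj)
    · exact hadj.elim
  rcases a with v | w
  · by_contra hv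
    have hw : Sum.inr ⟨π.index v, ⟨0, (n _).pos⟩⟩ ∈ D :=
      (hD (v := Sum.inl v) (w := Sum.inr ⟨π.index v, ⟨0, (n _).pos⟩⟩) rfl).resolve_left hv
    obtain ⟨hwC, hne⟩ := (hr _).1 (hDC hw)
    obtain ⟨u, hu, huD, huC⟩ := hout _ hwC hne
    have hvC : Sum.inl v ∈ C := ((hl v).1 ha).resolve_right fun h => hne (by rw [h])
    have huv : G.Adj u v :=
      π.isClique (π.index v) hu rfl fun h => huC (by rw [h]; exact hvC)
    exact (hD (v := Sum.inl u) (w := Sum.inl v) huv).elim huD hv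
  · obtain ⟨hwC, hne⟩ := (hr w).1 ha
    obtain ⟨u, hu, huD, -⟩ := hout w hwC hne
    exact (hD (v := Sum.inl u) (w := Sum.inr w) hu).resolve_left huD

/-- The symbols `f(C; τ)` that index the basis of the `i`-th free module: `C` is a minimal vertex
cover of `G^π[n_1, …, n_r]` and `τ` is a subset of `V(G) \ C` with `i` elements. -/
structure ResolutionSymbol {V : Type*} [Fintype V] [DecidableEq V] {G : SimpleGraph V} {r : ℕ}
    (π : CliquePartition G r) (n : Fin r → ℕ+) (i : ℕ) where
  cover : Finset (WhiskerVertex V n)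
  isMinimal : IsMinimalVertexCover (multiCliqueWhiskered π n) cover
  sub : Finset V
  mem_powersetCard : sub ∈ (uncovered cover).powersetCard i

namespace ResolutionSymbol

/-- The symbol `f(C; τ \ {x})` for `x ∈ τ`. -/
def erase {V : Type*} [Fintype V] [DecidableEq V] {G : SimpleGraph V} {r : ℕ}
    {π : CliquePartition G r} {n : Fin r → ℕ+} {i : ℕ} (b : ResolutionSymbol π n (i + 1))
    (x : V) (hx : x ∈ b.sub) : ResolutionSymbol π n i where
  cover := b.cover
  isMinimal := b.isMinimal
  sub := b.sub.erase x
  mem_powersetCard := by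
    have h := Finset.mem_powersetCard.1 b.mem_powersetCard
    refine Finset.mem_powersetCard.2 ⟨(Finset.erase_subset _ _).trans h.1, ?_⟩
    rw [Finset.card_erase_of_mem hx, h.2]
    rfl

/-- The symbol `f((C \ {w_{i,1}, …, w_{i,n_i}}) ∪ {x}; τ \ {x})` for `x ∈ τ` in the block `W_i`. -/
def swap {V : Type*} [Fintype V] [DecidableEq V] {G : SimpleGraph V} {r : ℕ}
    {π : CliquePartition G r} {n : Fin r → ℕ+} {i : ℕ} (b : ResolutionSymbol π n (i + 1))
    (x : V) (hx : x ∈ b.sub) : ResolutionSymbol π n i where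
  cover := swapCover π b.cover x
  isMinimal := isMinimalVertexCover_swapCover π b.isMinimal
    (Finset.mem_filter.1 ((Finset.mem_powersetCard.1 b.mem_powersetCard).1 hx)).2
  sub := b.sub.erase x
  mem_powersetCard := by
    have h := Finset.mem_powersetCard.1 b.mem_powersetCard
    refine Finset.mem_powersetCard.2 ⟨fun y hy => ?_, ?_⟩
    · obtain ⟨hyx, hy⟩ := Finset.mem_erase.1 hy
      have := (Finset.mem_filter.1 (h.1 hy)).2
      simp [uncovered, swapCover, hyx, this]
    · rw [Finset.card_erase_of_mem hx, h.2]
      rfl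

end ResolutionSymbol

/-- The variable `X_x` of a vertex `x` of `G`. -/
noncomputable def xVar (k : Type*) [Field k] {V : Type*} {r : ℕ} (n : Fin r → ℕ+) (x : V) :
    MvPolynomial (WhiskerVertex V n) k :=
  MvPolynomial.X (Sum.inl x)

/-- The product `w_{i,1} ⋯ w_{i,n_i}`. -/
noncomputable def wProd (k : Type*) [Field k] (V : Type*) {r : ℕ} (n : Fin r → ℕ+) (i : Fin r) :
    MvPolynomial (WhiskerVertex V n) k :=
  ∏ j : Fin (n i : ℕ), MvPolynomial.X (Sum.inr ⟨i, j⟩)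

/-- The differential from the `(i + 1)`-st to the `i`-th free module:
`d f(C; τ) = ∑_{x ∈ τ} (-1)^|{y ∈ τ | y > x}| (w_p f((C \ {w_{p,1}, …, w_{p,n_p}}) ∪ {x}; τ \ {x})
  - x f(C; τ \ {x}))`, where `p` is the index of the block of `x` and `w_p = w_{p,1} ⋯ w_{p,n_p}`. -/
noncomputable def coverDifferential (k : Type*) [Field k] {V : Type*} [Fintype V] [LinearOrder V]
    {G : SimpleGraph V} {r : ℕ} (π : CliquePartition G r) (n : Fin r → ℕ+) (i : ℕ) :
    (ResolutionSymbol π n (i + 1) →₀ MvPolynomial (WhiskerVertex V n) k)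
      →ₗ[MvPolynomial (WhiskerVertex V n) k]
    (ResolutionSymbol π n i →₀ MvPolynomial (WhiskerVertex V n) k) :=
  Finsupp.linearCombination _ fun b : ResolutionSymbol π n (i + 1) =>
    ∑ x ∈ b.sub.attach, (-1 : MvPolynomial (WhiskerVertex V n) k) ^
        (b.sub.filter fun y => x.1 < y).card •
      (Finsupp.single (b.swap x.1 x.2) (wProd k V n (π.index x.1)) -
        Finsupp.single (b.erase x.1 x.2) (xVar k n x.1))

theorem prod_mem_coverIdeal (k : Type*) [Field k] {W : Type*} {H : SimpleGraph W}
    {C : Finset W} (hC : IsMinimalVertexCover H C) :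
    (∏ v ∈ C, MvPolynomial.X v : MvPolynomial W k) ∈ coverIdeal k H :=
  Ideal.subset_span ⟨C, hC.prop, rfl⟩

/-- The augmentation from the `0`-th free module to the cover ideal: it sends `f(C; ∅)` to
`z_C = ∏_{v ∈ C} X_v`. -/
noncomputable def coverAugmentation (k : Type*) [Field k] {V : Type*} [Fintype V] [LinearOrder V]
    {G : SimpleGraph V} {r : ℕ} (π : CliquePartition G r) (n : Fin r → ℕ+) :
    (ResolutionSymbol π n 0 →₀ MvPolynomial (WhiskerVertex V n) k)
      →ₗ[MvPolynomial (WhiskerVertex V n) k] coverIdeal k (multiCliqueWhiskered π n) :=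
  Finsupp.linearCombination _ fun b : ResolutionSymbol π n 0 =>
    ⟨∏ v ∈ b.cover, MvPolynomial.X v, prod_mem_coverIdeal k b.isMinimal⟩

/-- The explicit sequence of free modules ending in the cover ideal of `G^π[n_1, …, n_r]`. The basis
of the `i`-th module consists of the symbols `f(C; τ)` with `|τ| = i`, in the multidegree of
`z_C x_τ`. -/
noncomputable def coverSequence (k : Type*) [Field k] {V : Type*} [Fintype V] [LinearOrder V]
    {G : SimpleGraph V} {r : ℕ} (π : CliquePartition G r) (n : Fin r → ℕ+) :
    AugmentedFreeSequence k (coverIdeal k (multiCliqueWhiskered π n)) where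
  ι i := ResolutionSymbol π n i
  deg _ b := (∑ v ∈ b.cover, Finsupp.single v 1) + ∑ x ∈ b.sub, Finsupp.single (Sum.inl x) 1
  d i := coverDifferential k π n i
  aug := coverAugmentation k π n

/-- The substitution from the polynomial ring of `G^π` to that of `G^π[n_1, …, n_r]` which fixes the
variables of `G` and replaces `w_i` by `w_{i,1} ⋯ w_{i,n_i}`. -/
noncomputable def whiskerSubstitution (k : Type*) [Field k] (V : Type*) {r : ℕ}
    (n : Fin r → ℕ+) :
    MvPolynomial (WhiskerVertex V fun _ : Fin r => 1) k →ₐ[k] MvPolynomial (WhiskerVertex V n) k :=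
  MvPolynomial.aeval (Sum.elim (fun x => xVar k n x) fun w => wProd k V n w.1)

/-! A minimal vertex cover C is determined by the independent set I = V(G) \ C: a whisker lies in C
exactly when its block meets I. The blocks are cliques, so I meets each of them at most once. The
symbol f(C; τ) becomes a pair (I, τ) with τ ⊆ I, of multidegree x_{V \ I} w_I x_τ, whose face at x
is w_{p(x)} (I \ x, τ \ x) - x (I, τ \ x).

Read (I, τ) as the cube of all sets between I \ τ and I. For a monomial M, let Z be the set of
vertices whose variable does not divide M. The strand of multidegree M is the cubical chain complex
of the cubes with I independent, w_I dividing M and Z ⊆ I \ τ. Such sets I may be shrunk down to Z,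
so the complex, if nonempty, contracts to the vertex Z, and it is nonempty exactly when M lies in
the cover ideal. This gives exactness over every field.

The contraction is explicit: walk from I to Z, removing the elements of I \ Z from the largest
downwards; on a cube (I, τ) only the elements above all of τ are removed.
`pairDifferential_homotopyValue` and `homotopyValue_sub` compute dh and hd. They add up to the
identity for τ ≠ ∅ (`pairDifferential_add_pairHomotopy`); for τ = ∅, dh is the identity minus the
passage to Z (`pairDifferential_pairHomotopy_empty`).

These computations take place in the free module on all pairs. Independence enters through the
embedding of the symbols, whose image is preserved because subsets of independent sets are
independent. In terms of pairs, n is visible only in the products w_i, which yields the substitution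
statement. -/

open MvPolynomial

/-! ### The cubical complex on all pairs of vertex sets -/

section CubicalComplex

variable {V : Type*} {r : ℕ}

/-- The exponent of the monomial `∏_{v ∈ A} X_v` for a set `A` of vertices of `G`. -/
noncomputable def xExp (n : Fin r → ℕ+) (A : Finset V) : WhiskerVertex V n →₀ ℕ :=
  ∑ v ∈ A, Finsupp.single (Sum.inl v) 1

/-- The exponent of the monomial `∏_{v ∈ A} w_{p(v)}`. -/
noncomputable def wExp (n : Fin r → ℕ+) (p : V → Fin r) (A : Finset V) :
    WhiskerVertex V n →₀ ℕ :=
  ∑ v ∈ A, ∑ j : Fin (n (p v) : ℕ), Finsupp.single (Sum.inr ⟨p v, j⟩) 1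

@[simp]
theorem xExp_inl [DecidableEq V] (n : Fin r → ℕ+) (A : Finset V) (v : V) :
    xExp n A (Sum.inl v) = if v ∈ A then 1 else 0 := by
  simp [xExp, Finsupp.finsetSum_apply, Finsupp.single_apply]

@[simp]
theorem xExp_inr (n : Fin r → ℕ+) (A : Finset V) (w : Σ i : Fin r, Fin (n i : ℕ)) :
    xExp n A (Sum.inr w) = 0 := by
  simp [xExp, Finsupp.finsetSum_apply]

@[simp]
theorem wExp_inl (n : Fin r → ℕ+) (p : V → Fin r) (A : Finset V) (v : V) :
    wExp n p A (Sum.inl v) = 0 := by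
  simp [wExp, Finsupp.finsetSum_apply]

theorem wExp_insert [DecidableEq V] (n : Fin r → ℕ+) (p : V → Fin r) {A : Finset V} {x : V}
    (hx : x ∉ A) : wExp n p (insert x A) = wExp n p {x} + wExp n p A := by
  simp [wExp, Finset.sum_insert hx]

theorem wExp_sdiff_add [DecidableEq V] (n : Fin r → ℕ+) (p : V → Fin r) {A B : Finset V}
    (h : B ⊆ A) : wExp n p (A \ B) + wExp n p B = wExp n p A :=
  Finset.sum_sdiff h

theorem monomial_wExp_singleton (k : Type*) [Field k] (n : Fin r → ℕ+) (p : V → Fin r) (x : V) :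
    monomial (wExp n p {x}) (1 : k) = wProd k V n (p x) := by
  simp [wExp, wProd, monomial_sum_one, X]

theorem monomial_xExp_singleton (k : Type*) [Field k] (n : Fin r → ℕ+) (x : V) :
    monomial (xExp n {x}) (1 : k) = xVar k n x := by
  simp [xExp, xVar, X]

variable [LinearOrder V]

/-- The free module on all pairs `(I, τ)` of sets of vertices. -/
abbrev PairModule (k : Type*) [Field k] (V : Type*) (n : Fin r → ℕ+) :=
  Finset V × Finset V →₀ MvPolynomial (WhiskerVertex V n) k

/-- The number of elements of `τ` above `x`. -/
def above (τ : Finset V) (x : V) : ℕ := (τ.filter fun y => x < y).card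

/-- The `x`-th face `w_{p(x)} (I \ {x}, τ \ {x}) - x (I, τ \ {x})` of the pair `(I, τ)`. -/
noncomputable def pairFace (k : Type*) [Field k] (n : Fin r → ℕ+) (p : V → Fin r)
    (I τ : Finset V) (x : V) : PairModule k V n :=
  Finsupp.single (I.erase x, τ) (wProd k V n (p x)) - Finsupp.single (I, τ) (xVar k n x)

/-- The differential of the free module on all pairs. -/
noncomputable def pairDifferential (k : Type*) [Field k] (n : Fin r → ℕ+) (p : V → Fin r) :
    PairModule k V n →ₗ[MvPolynomial (WhiskerVertex V n) k] PairModule k V n :=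
  Finsupp.linearCombination _ fun b : Finset V × Finset V =>
    ∑ x ∈ b.2, (-1 : MvPolynomial (WhiskerVertex V n) k) ^ above b.2 x •
      pairFace k n p b.1 (b.2.erase x) x

theorem pairDifferential_single (k : Type*) [Field k] (n : Fin r → ℕ+) (p : V → Fin r)
    (I τ : Finset V) (q : MvPolynomial (WhiskerVertex V n) k) :
    pairDifferential k n p (Finsupp.single (I, τ) q) =
      ∑ x ∈ τ, (-1 : MvPolynomial (WhiskerVertex V n) k) ^ above τ x •
        q • pairFace k n p I (τ.erase x) x := by
  simp only [pairDifferential, Finsupp.linearCombination_single, Finset.smul_sum]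
  exact Finset.sum_congr rfl fun x _ => smul_comm _ _ _

theorem above_erase_of_lt {τ : Finset V} {x y : V} (hy : y ∈ τ) (h : x < y) :
    above τ x = above (τ.erase y) x + 1 := by
  rw [above, above, Finset.filter_erase, Finset.card_erase_add_one]
  simp [hy, h]

theorem above_erase_of_gt {τ : Finset V} {x y : V} (h : y < x) :
    above (τ.erase y) x = above τ x := by
  rw [above, above, Finset.filter_erase, Finset.erase_eq_of_notMem]
  simp [h.le]

/-- Erasing the larger of the two elements lowers the count at the smaller one by 1, whereas erasing
the smaller leaves the count at the larger unchanged. -/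
theorem sign_antisymm {R : Type*} [CommRing R] {τ : Finset V} {x y : V} (hx : x ∈ τ) (hy : y ∈ τ)
    (h : x ≠ y) :
    (-1 : R) ^ above τ x * (-1) ^ above (τ.erase x) y =
      -((-1 : R) ^ above τ y * (-1) ^ above (τ.erase y) x) := by
  rcases lt_or_gt_of_ne h with h | h
  · rw [above_erase_of_gt h, above_erase_of_lt hy h]; ring
  · rw [above_erase_of_gt h, above_erase_of_lt hx h]; ring

theorem pairDifferential_comp_self (k : Type*) [Field k] (n : Fin r → ℕ+) (p : V → Fin r)
    (z : PairModule k V n) : pairDifferential k n p (pairDifferential k n p z) = 0 := by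
  have key : pairDifferential k n p ∘ₗ pairDifferential k n p = 0 := by
    refine Finsupp.lhom_ext' fun ⟨I, τ⟩ => LinearMap.ext_ring ?_
    -- The iterated face at x and then y, without signs. It is symmetric because faces in different
    -- directions commute.
    let g : V → V → PairModule k V n := fun x y =>
      wProd k V n (p x) • pairFace k n p (I.erase x) ((τ.erase x).erase y) y -
        xVar k n x • pairFace k n p I ((τ.erase x).erase y) y
    have hg : ∀ x y, g x y = g y x := by
      intro x y
      simp only [g, pairFace, smul_sub, Finsupp.smul_single, smul_eq_mul,
        Finset.erase_right_comm (a := x) (b := y), mul_comm (wProd k V n (p x)),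
        mul_comm (xVar k n x)]
      abel
    have h1 : pairDifferential k n p (pairDifferential k n p (Finsupp.single (I, τ) 1)) =
        ∑ x ∈ τ, ∑ y ∈ τ.erase x, ((-1 : MvPolynomial (WhiskerVertex V n) k) ^ above τ x *
          (-1) ^ above (τ.erase x) y) • g x y := by
      rw [pairDifferential_single, map_sum]
      refine Finset.sum_congr rfl fun x _ => ?_
      rw [one_smul, map_smul, pairFace, map_sub, pairDifferential_single, pairDifferential_single,
        ← Finset.sum_sub_distrib, Finset.smul_sum]
      refine Finset.sum_congr rfl fun y _ => ?_
      rw [← smul_sub, mul_smul]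
    change pairDifferential k n p (pairDifferential k n p (Finsupp.single (I, τ) 1)) = 0
    rw [h1, Finset.sum_sigma']
    -- The summands at (x, y) and (y, x) cancel.
    refine Finset.sum_involution (fun a _ => ⟨a.2, a.1⟩) ?_ ?_ ?_ ?_
    · rintro ⟨x, y⟩ ha
      simp only [Finset.mem_sigma, Finset.mem_erase] at ha
      simp only
      rw [sign_antisymm ha.1 ha.2.2 (Ne.symm ha.2.1), hg x y, neg_smul, neg_add_cancel]
    · rintro ⟨x, y⟩ ha _ h
      simp only [Finset.mem_sigma, Finset.mem_erase] at ha
      exact ha.2.1 (congrArg Sigma.fst h)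
    · rintro ⟨x, y⟩ ha
      simp only [Finset.mem_sigma, Finset.mem_erase] at ha ⊢
      exact ⟨ha.2.2, Ne.symm ha.2.1, ha.1⟩
    · rintro ⟨x, y⟩ _
      rfl
  exact LinearMap.congr_fun key z

end CubicalComplex

/-! ### The contracting homotopy -/

section Homotopy

variable {V : Type*} {r : ℕ} [LinearOrder V]

/-- The elements of `I` above all of `τ` whose variable occurs in the monomial `X^e`. -/
def freeAbove {n : Fin r → ℕ+} (I τ : Finset V) (e : WhiskerVertex V n →₀ ℕ) : Finset V :=
  I.filter fun z => e (Sum.inl z) ≠ 0 ∧ ∀ s ∈ τ, s < z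

theorem mem_freeAbove {n : Fin r → ℕ+} {I τ : Finset V} {e : WhiskerVertex V n →₀ ℕ} {z : V} :
    z ∈ freeAbove I τ e ↔ z ∈ I ∧ e (Sum.inl z) ≠ 0 ∧ ∀ s ∈ τ, s < z := by
  simp [freeAbove]

/-- The monomial `X^e` with `x_A` replaced by `∏_{v ∈ B} w_{p(v)}`. -/
noncomputable def exchange (k : Type*) [Field k] {n : Fin r → ℕ+} (p : V → Fin r)
    (e : WhiskerVertex V n →₀ ℕ) (A B : Finset V) : MvPolynomial (WhiskerVertex V n) k :=
  monomial (e - xExp n A + wExp n p B) 1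

/-- The summand at `x ∈ T` of the contracting homotopy. -/
noncomputable def homotopyTerm (k : Type*) [Field k] {n : Fin r → ℕ+} (p : V → Fin r)
    (I τ : Finset V) (e : WhiskerVertex V n →₀ ℕ) (T : Finset V) (x : V) : PairModule k V n :=
  Finsupp.single (I \ T.filter (x < ·), insert x τ)
    (exchange k p e (T.filter (x ≤ ·)) (T.filter (x < ·)))

/-- The value of the contracting homotopy at `X^e (I, τ)`. -/
noncomputable def homotopyValue (k : Type*) [Field k] {n : Fin r → ℕ+} (p : V → Fin r)
    (I τ : Finset V) (e : WhiskerVertex V n →₀ ℕ) : PairModule k V n :=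
  -∑ x ∈ freeAbove I τ e, homotopyTerm k p I τ e (freeAbove I τ e) x

/-- The contracting homotopy. -/
noncomputable def pairHomotopy (k : Type*) [Field k] (n : Fin r → ℕ+) (p : V → Fin r) :
    PairModule k V n →ₗ[k] PairModule k V n :=
  Finsupp.lsum k fun b : Finset V × Finset V =>
    (basisMonomials (WhiskerVertex V n) k).constr k fun e => homotopyValue k p b.1 b.2 e

theorem pairHomotopy_single (k : Type*) [Field k] {n : Fin r → ℕ+} (p : V → Fin r)
    (I τ : Finset V) (e : WhiskerVertex V n →₀ ℕ) :
    pairHomotopy k n p (Finsupp.single (I, τ) (monomial e 1)) = homotopyValue k p I τ e := by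
  rw [pairHomotopy, Finsupp.lsum_single]
  have := (basisMonomials (WhiskerVertex V n) k).constr_basis k
    (fun e => homotopyValue k p I τ e) e
  rwa [coe_basisMonomials] at this

/-- For consecutive elements x < x' of T, the elements above x are those from x' on, so neighbouring
summands cancel. -/
theorem sum_filter_telescope {M : Type*} [AddCommGroup M] (g : Finset V → M) (T : Finset V) :
    ∑ x ∈ T, (g (T.filter (x < ·)) - g (T.filter (x ≤ ·))) = g ∅ - g T := by
  induction T using Finset.induction_on_min with
  | empty => simp
  | insert a T ha ih =>
    have haT : a ∉ T := fun h => lt_irrefl a (ha a h)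
    rw [Finset.sum_insert haT]
    have h1 : (insert a T).filter (a < ·) = T := by
      ext z
      simp only [Finset.mem_filter, Finset.mem_insert]
      exact ⟨fun h => h.1.resolve_left h.2.ne', fun h => ⟨Or.inr h, ha z h⟩⟩
    have h2 : (insert a T).filter (a ≤ ·) = insert a T := by
      refine Finset.filter_true_of_mem fun z hz => ?_
      rcases Finset.mem_insert.1 hz with rfl | hz
      · exact le_rfl
      · exact (ha z hz).le
    have h3 : ∑ x ∈ T, (g ((insert a T).filter (x < ·)) - g ((insert a T).filter (x ≤ ·))) =
        ∑ x ∈ T, (g (T.filter (x < ·)) - g (T.filter (x ≤ ·))) := by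
      refine Finset.sum_congr rfl fun x hx => ?_
      rw [Finset.filter_insert, Finset.filter_insert, if_neg (ha x hx).not_gt,
        if_neg (ha x hx).not_ge]
    rw [h1, h2, h3, ih]
    abel

theorem filter_le_eq_insert {T : Finset V} {x : V} (hx : x ∈ T) :
    T.filter (x ≤ ·) = insert x (T.filter (x < ·)) := by
  ext z
  simp only [Finset.mem_filter, Finset.mem_insert, le_iff_lt_or_eq]
  grind

theorem wProd_mul_exchange (k : Type*) [Field k] {n : Fin r → ℕ+} (p : V → Fin r)
    (e : WhiskerVertex V n →₀ ℕ) {A B : Finset V} {x : V} (hx : x ∉ B) :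
    wProd k V n (p x) * exchange k p e A B = exchange k p e A (insert x B) := by
  rw [← monomial_wExp_singleton, exchange, exchange, monomial_mul, one_mul, wExp_insert n p hx,
    add_left_comm]

/-- The subtraction of exponents in `exchange` is truncated; `he` makes it exact at x. -/
theorem xVar_mul_exchange (k : Type*) [Field k] {n : Fin r → ℕ+} (p : V → Fin r)
    (e : WhiskerVertex V n →₀ ℕ) {A B : Finset V} {x : V} (hx : x ∉ A) (he : e (Sum.inl x) ≠ 0) :
    xVar k n x * exchange k p e (insert x A) B = exchange k p e A B := by
  rw [← monomial_xExp_singleton, exchange, exchange, monomial_mul, one_mul]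
  congr 2
  ext (v | w)
  · simp only [Finsupp.add_apply, Finsupp.tsub_apply, xExp_inl, wExp_inl, Finset.mem_singleton,
      Finset.mem_insert]
    rcases eq_or_ne v x with rfl | h
    · simp [hx]; lia
    · simp [h]
  · simp

theorem exchange_add_wExp (k : Type*) [Field k] {n : Fin r → ℕ+} (p : V → Fin r)
    (e : WhiskerVertex V n →₀ ℕ) (A B : Finset V) (y : V) :
    exchange k p (e + wExp n p {y}) A B = exchange k p e A B * wProd k V n (p y) := by
  rw [← monomial_wExp_singleton, exchange, exchange, monomial_mul, one_mul]
  congr 2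
  ext (v | w)
  · simp
  · simp; lia

theorem exchange_add_xExp (k : Type*) [Field k] {n : Fin r → ℕ+} (p : V → Fin r)
    (e : WhiskerVertex V n →₀ ℕ) {A B : Finset V} {y : V} (hy : y ∉ A) :
    exchange k p (e + xExp n {y}) A B = exchange k p e A B * xVar k n y := by
  rw [← monomial_xExp_singleton, exchange, exchange, monomial_mul, one_mul]
  congr 2
  ext (v | w)
  · simp only [Finsupp.add_apply, Finsupp.tsub_apply, xExp_inl, wExp_inl, Finset.mem_singleton]
    rcases eq_or_ne v y with rfl | h
    · simp [hy]
    · simp [h]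
  · simp

theorem exchange_add_xExp_insert (k : Type*) [Field k] {n : Fin r → ℕ+} (p : V → Fin r)
    (e : WhiskerVertex V n →₀ ℕ) {A B : Finset V} {y : V} (hy : y ∉ A) :
    exchange k p (e + xExp n {y}) (insert y A) B = exchange k p e A B := by
  rw [exchange, exchange]
  congr 2
  ext (v | w)
  · simp only [Finsupp.add_apply, Finsupp.tsub_apply, xExp_inl, wExp_inl, Finset.mem_singleton,
      Finset.mem_insert]
    rcases eq_or_ne v y with rfl | h
    · simp [hy]
    · simp [h]
  · simp

theorem above_insert_self {τ : Finset V} {x : V} (h : ∀ s ∈ τ, s < x) :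
    above (insert x τ) x = 0 := by
  rw [above, Finset.card_eq_zero, Finset.filter_eq_empty_iff]
  intro y hy
  rcases Finset.mem_insert.1 hy with rfl | hy
  · exact lt_irrefl _
  · exact (h y hy).not_gt

/-- The faces in the new directions x are the ends of the edges of the walk from I to I \ T, where T
is `freeAbove I τ e`. They telescope to the difference of its two endpoints. The faces in the old
directions y ∈ τ remain and are to be cancelled by hd. -/
theorem pairDifferential_homotopyValue (k : Type*) [Field k] {n : Fin r → ℕ+} (p : V → Fin r)
    (I τ : Finset V) (e : WhiskerVertex V n →₀ ℕ) :
    pairDifferential k n p (homotopyValue k p I τ e) =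
      Finsupp.single (I, τ) (monomial e 1) -
        Finsupp.single (I \ freeAbove I τ e, τ)
          (exchange k p e (freeAbove I τ e) (freeAbove I τ e)) +
      ∑ y ∈ τ, (-1 : MvPolynomial (WhiskerVertex V n) k) ^ above τ y •
        ∑ x ∈ freeAbove I τ e,
          exchange k p e ((freeAbove I τ e).filter (x ≤ ·)) ((freeAbove I τ e).filter (x < ·)) •
            pairFace k n p (I \ (freeAbove I τ e).filter (x < ·)) (insert x (τ.erase y)) y := by
  have hT : ∀ x ∈ freeAbove I τ e, e (Sum.inl x) ≠ 0 ∧ ∀ s ∈ τ, s < x :=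
    fun x hx => (mem_freeAbove.1 hx).2
  rw [homotopyValue]
  generalize freeAbove I τ e = T at hT ⊢
  -- The station of the walk at which the elements of A have been removed from I.
  set g : Finset V → PairModule k V n := fun A =>
    Finsupp.single (I \ A, τ) (exchange k p e A A) with hg
  have hterm : ∀ x ∈ T, pairDifferential k n p (homotopyTerm k p I τ e T x) =
      -(g (T.filter (x < ·)) - g (T.filter (x ≤ ·))) -
      ∑ y ∈ τ, (-1 : MvPolynomial (WhiskerVertex V n) k) ^ above τ y •
          exchange k p e (T.filter (x ≤ ·)) (T.filter (x < ·)) •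
            pairFace k n p (I \ T.filter (x < ·)) (insert x (τ.erase y)) y := by
    intro x hx
    have hxτ : x ∉ τ := fun h => lt_irrefl x ((hT x hx).2 x h)
    have hxlt : x ∉ T.filter (x < ·) := by simp
    rw [homotopyTerm, pairDifferential_single, Finset.sum_insert hxτ,
      above_insert_self (hT x hx).2, pow_zero, one_smul, Finset.erase_insert hxτ, sub_eq_add_neg]
    congr 1
    · rw [pairFace, smul_sub, Finsupp.smul_single, Finsupp.smul_single, smul_eq_mul, smul_eq_mul,
        mul_comm _ (wProd k V n (p x)), mul_comm _ (xVar k n x), wProd_mul_exchange k p e hxlt,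
        filter_le_eq_insert hx, xVar_mul_exchange k p e hxlt (hT x hx).1, hg,
        ← Finset.sdiff_insert]
      simp only
      abel
    · rw [← Finset.sum_neg_distrib]
      refine Finset.sum_congr rfl fun y hy => ?_
      -- Since x lies above y, inserting it flips the sign of the face at y.
      have hyx := (hT x hx).2 y hy
      have hne : x ≠ y := hyx.ne'
      rw [Finset.erase_insert_of_ne hne,
        above_erase_of_lt (Finset.mem_insert_self x τ) hyx, Finset.erase_insert hxτ, pow_succ,
        mul_neg_one, neg_smul]
  rw [map_neg, map_sum, Finset.sum_congr rfl hterm, Finset.sum_sub_distrib,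
    Finset.sum_neg_distrib, sum_filter_telescope, Finset.sum_comm]
  simp only [← Finset.smul_sum]
  have h0 : g ∅ = Finsupp.single (I, τ) (monomial e 1) := by
    simp [hg, exchange, xExp, wExp]
  rw [h0]
  abel

theorem homotopyTerm_sub (k : Type*) [Field k] {n : Fin r → ℕ+} (p : V → Fin r)
    (I τ : Finset V) (e : WhiskerVertex V n →₀ ℕ) {T : Finset V} {x y : V} (h : y < x) :
    homotopyTerm k p (I.erase y) τ (e + wExp n p {y}) T x -
        homotopyTerm k p I τ (e + xExp n {y}) T x =
      exchange k p e (T.filter (x ≤ ·)) (T.filter (x < ·)) •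
        pairFace k n p (I \ T.filter (x < ·)) (insert x τ) y := by
  have hy : y ∉ T.filter (x ≤ ·) := by simp [h]
  rw [homotopyTerm, homotopyTerm, exchange_add_wExp, exchange_add_xExp k p e hy, pairFace,
    smul_sub, Finsupp.smul_single, Finsupp.smul_single, Finset.erase_sdiff_comm]
  rfl

/-- This is h applied to the face at y. If y is not the maximum of τ, both ends of the face have the
same removable elements as (I, τ), and the values are compared term by term. If y is the maximum,
erasing it makes smaller elements removable too, and y itself on the end that keeps y in I. The
terms below y cancel, and the term at y is the endpoint of the walk that dh leaves over. -/
theorem homotopyValue_sub (k : Type*) [Field k] {n : Fin r → ℕ+} (p : V → Fin r)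
    {I τ : Finset V} (hτ : τ ⊆ I) (e : WhiskerVertex V n →₀ ℕ) {y : V} (hy : y ∈ τ) :
    homotopyValue k p (I.erase y) (τ.erase y) (e + wExp n p {y}) -
        homotopyValue k p I (τ.erase y) (e + xExp n {y}) =
      (if ∀ s ∈ τ, s ≤ y then Finsupp.single (I \ freeAbove I τ e, τ)
          (exchange k p e (freeAbove I τ e) (freeAbove I τ e)) else 0) -
        ∑ x ∈ freeAbove I τ e,
          exchange k p e ((freeAbove I τ e).filter (x ≤ ·)) ((freeAbove I τ e).filter (x < ·)) •
            pairFace k n p (I \ (freeAbove I τ e).filter (x < ·)) (insert x (τ.erase y)) y := by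
  split_ifs with hmax
  · set T := freeAbove I τ e with hT
    set T₁ := freeAbove (I.erase y) (τ.erase y) (e + wExp n p {y}) with hT₁
    have hy₁ : y ∉ T₁ := fun h => Finset.notMem_erase y I (mem_freeAbove.1 h).1
    -- On this end y is removable: it lies in I, its variable has just been multiplied in, and it
    -- exceeds the rest of τ.
    have hT₂ : freeAbove I (τ.erase y) (e + xExp n {y}) = insert y T₁ := by
      ext z
      simp only [hT₁, mem_freeAbove, Finset.mem_insert, Finset.mem_erase, Finsupp.add_apply,
        xExp_inl, wExp_inl, Finset.mem_singleton]
      rcases eq_or_ne z y with rfl | hz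
      · simp only [hτ hy, true_and, if_true, true_or, iff_true]
        exact ⟨by lia, fun s hs => lt_of_le_of_ne (hmax s hs.2) hs.1⟩
      · simp [hz]
    have hTT₁ : T = T₁.filter (y < ·) := by
      ext z
      simp only [hT, hT₁, mem_freeAbove, Finset.mem_filter, Finset.mem_erase, Finsupp.add_apply,
        wExp_inl, add_zero]
      constructor
      · rintro ⟨hz, hez, h⟩
        exact ⟨⟨⟨(h y hy).ne', hz⟩, hez, fun s hs => h s hs.2⟩, h y hy⟩
      · rintro ⟨⟨⟨-, hz⟩, hez, h⟩, hyz⟩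
        exact ⟨hz, hez, fun s hs => (hmax s hs).trans_lt hyz⟩
    have hfilter : ∀ x, y < x → (insert y T₁).filter (x < ·) = T.filter (x < ·) ∧
        (insert y T₁).filter (x ≤ ·) = T.filter (x ≤ ·) ∧
        T₁.filter (x < ·) = T.filter (x < ·) ∧ T₁.filter (x ≤ ·) = T.filter (x ≤ ·) := by
      intro x hx
      rw [Finset.filter_insert, Finset.filter_insert, if_neg hx.not_gt, if_neg hx.not_ge, hTT₁,
        Finset.filter_filter, Finset.filter_filter]
      have h1 : T₁.filter (x < ·) = T₁.filter (fun z => y < z ∧ x < z) :=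
        Finset.filter_congr fun z _ => ⟨fun h => ⟨hx.trans h, h⟩, fun h => h.2⟩
      have h2 : T₁.filter (x ≤ ·) = T₁.filter (fun z => y < z ∧ x ≤ z) :=
        Finset.filter_congr fun z _ => ⟨fun h => ⟨hx.trans_le h, h⟩, fun h => h.2⟩
      exact ⟨h1, h2, h1, h2⟩
    -- Removing y puts it back into τ, after all of T has been removed.
    have hyterm : homotopyTerm k p I (τ.erase y) (e + xExp n {y}) (insert y T₁) y =
        Finsupp.single (I \ T, τ) (exchange k p e T T) := by
      have h1 : (insert y T₁).filter (y < ·) = T := by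
        rw [Finset.filter_insert, if_neg (lt_irrefl y), hTT₁]
      have hyT : y ∉ T := by rw [hTT₁]; simp
      rw [homotopyTerm, filter_le_eq_insert (Finset.mem_insert_self y T₁), h1,
        exchange_add_xExp_insert k p e hyT, Finset.insert_erase hy]
    have hdiff : ∀ x ∈ T₁,
        homotopyTerm k p (I.erase y) (τ.erase y) (e + wExp n p {y}) T₁ x -
          homotopyTerm k p I (τ.erase y) (e + xExp n {y}) (insert y T₁) x =
        if y < x then exchange k p e (T.filter (x ≤ ·)) (T.filter (x < ·)) •
            pairFace k n p (I \ T.filter (x < ·)) (insert x (τ.erase y)) y else 0 := by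
      intro x hx
      split_ifs with hyx
      · obtain ⟨h1, h2, h3, h4⟩ := hfilter x hyx
        rw [← homotopyTerm_sub k p I (τ.erase y) e hyx]
        simp only [homotopyTerm, h1, h2, h3, h4]
      -- For x < y the walk has already removed y on one end, while the other end starts without it;
      -- the two terms agree.
      · have hxy : x < y := lt_of_le_of_ne (not_lt.1 hyx) fun h => hy₁ (h ▸ hx)
        have hylt : y ∉ T₁.filter (x < ·) := fun h => hy₁ (Finset.mem_filter.1 h).1
        have hyle : y ∉ T₁.filter (x ≤ ·) := fun h => hy₁ (Finset.mem_filter.1 h).1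
        rw [sub_eq_zero, homotopyTerm, homotopyTerm, Finset.filter_insert, Finset.filter_insert,
          if_pos hxy, if_pos hxy.le, exchange_add_xExp_insert k p e hyle, exchange_add_wExp,
          mul_comm, wProd_mul_exchange k p e hylt, Finset.sdiff_insert, Finset.erase_sdiff_comm]
    rw [homotopyValue, homotopyValue, hT₂, Finset.sum_insert hy₁, hyterm]
    have h1 := Finset.sum_congr rfl hdiff
    rw [Finset.sum_sub_distrib, ← Finset.sum_filter, ← hTT₁] at h1
    rw [← h1]
    abel
  · push Not at hmax
    obtain ⟨s, hs, hys⟩ := hmax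
    -- The element s > y stays in τ, so erasing y does not change the bound on removable elements.
    have hlt : ∀ z, (∀ s ∈ τ.erase y, s < z) ↔ ∀ s ∈ τ, s < z := by
      refine fun z => ⟨fun h t ht => ?_, fun h t ht => h t (Finset.mem_of_mem_erase ht)⟩
      rcases eq_or_ne t y with rfl | hty
      · exact hys.trans (h s (Finset.mem_erase.2 ⟨hys.ne', hs⟩))
      · exact h t (Finset.mem_erase.2 ⟨hty, ht⟩)
    have hne : ∀ z, (∀ s ∈ τ, s < z) → z ≠ y := fun z h => (h y hy).ne'
    have hT₁ : freeAbove (I.erase y) (τ.erase y) (e + wExp n p {y}) = freeAbove I τ e := by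
      ext z
      simp only [mem_freeAbove, Finset.mem_erase, Finsupp.add_apply, wExp_inl, add_zero]
      rw [← hlt z]
      simp only [Finset.mem_erase]
      have := hne z
      rw [← hlt z] at this
      simp only [Finset.mem_erase] at this
      tauto
    have hT₂ : freeAbove I (τ.erase y) (e + xExp n {y}) = freeAbove I τ e := by
      ext z
      rw [mem_freeAbove, mem_freeAbove, hlt z]
      refine and_congr_right fun _ => and_congr_left fun h => ?_
      simp [hne z h]
    rw [homotopyValue, homotopyValue, hT₁, hT₂, neg_sub_neg, ← neg_sub, ← Finset.sum_sub_distrib,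
      zero_sub, neg_inj]
    exact Finset.sum_congr rfl fun x hx =>
      homotopyTerm_sub k p I (τ.erase y) e ((mem_freeAbove.1 hx).2.2 y hy)

/-- The homotopy is only k-linear, so signs in the polynomial ring are moved through it by
additivity. -/
theorem map_neg_one_pow_smul {R M N F : Type*} [CommRing R] [AddCommGroup M] [AddCommGroup N]
    [Module R M] [Module R N] [FunLike F M N] [AddMonoidHomClass F M N] (f : F) (m : ℕ) (z : M) :
    f ((-1 : R) ^ m • z) = (-1 : R) ^ m • f z := by
  rcases neg_one_pow_eq_or R m with h | h <;> simp [h]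

/-- The old-direction faces cancel between dh and hd. Exactly one y ∈ τ, the maximum, contributes
the endpoint of the walk, with sign +1, and so cancels the endpoint in dh. -/
theorem pairDifferential_add_pairHomotopy (k : Type*) [Field k] {n : Fin r → ℕ+} (p : V → Fin r)
    {I τ : Finset V} (hτ : τ ⊆ I) (hne : τ.Nonempty) (e : WhiskerVertex V n →₀ ℕ) :
    pairDifferential k n p (pairHomotopy k n p (Finsupp.single (I, τ) (monomial e 1))) +
      pairHomotopy k n p (pairDifferential k n p (Finsupp.single (I, τ) (monomial e 1))) =
    Finsupp.single (I, τ) (monomial e 1) := by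
  have h1 : ∀ y ∈ τ, pairHomotopy k n p ((-1 : MvPolynomial (WhiskerVertex V n) k) ^ above τ y •
      (monomial e 1 : MvPolynomial (WhiskerVertex V n) k) • pairFace k n p I (τ.erase y) y) =
      (if y = τ.max' hne then Finsupp.single (I \ freeAbove I τ e, τ)
          (exchange k p e (freeAbove I τ e) (freeAbove I τ e)) else 0) -
        (-1 : MvPolynomial (WhiskerVertex V n) k) ^ above τ y • ∑ x ∈ freeAbove I τ e,
          exchange k p e ((freeAbove I τ e).filter (x ≤ ·)) ((freeAbove I τ e).filter (x < ·)) •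
            pairFace k n p (I \ (freeAbove I τ e).filter (x < ·)) (insert x (τ.erase y)) y := by
    intro y hy
    rw [map_neg_one_pow_smul, pairFace, smul_sub, Finsupp.smul_single, Finsupp.smul_single,
      ← monomial_wExp_singleton, ← monomial_xExp_singleton, smul_eq_mul, smul_eq_mul,
      monomial_mul, monomial_mul, one_mul, map_sub, pairHomotopy_single, pairHomotopy_single,
      homotopyValue_sub k p hτ e hy, smul_sub]
    congr 1
    by_cases hmax : ∀ s ∈ τ, s ≤ y
    · have h2 : above τ y = 0 := by
        rw [above, Finset.card_eq_zero, Finset.filter_eq_empty_iff]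
        exact fun s hs => (hmax s hs).not_gt
      rw [if_pos hmax, if_pos (le_antisymm (τ.le_max' y hy) (hmax _ (τ.max'_mem hne))), h2,
        pow_zero, one_smul]
    · rw [if_neg hmax, if_neg fun h => hmax fun s hs => (τ.le_max' s hs).trans_eq h.symm, smul_zero]
  rw [pairHomotopy_single, pairDifferential_homotopyValue, pairDifferential_single, map_sum,
    Finset.sum_congr rfl h1, Finset.sum_sub_distrib, Finset.sum_ite_eq', if_pos (τ.max'_mem hne)]
  abel

end Homotopy

/-! ### Multidegrees and the end of the walk in degree zero -/

section Degrees

variable {V : Type*} {r : ℕ}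

theorem monomial_xExp (k : Type*) [Field k] (n : Fin r → ℕ+) (A : Finset V) :
    monomial (xExp n A) (1 : k) = ∏ x ∈ A, xVar k n x := by
  simp [xExp, xVar, X, monomial_sum_one]

theorem monomial_wExp (k : Type*) [Field k] (n : Fin r → ℕ+) (p : V → Fin r) (A : Finset V) :
    monomial (wExp n p A) (1 : k) = ∏ x ∈ A, wProd k V n (p x) := by
  simp [wExp, wProd, X, monomial_sum_one]

variable [LinearOrder V]

theorem xExp_add_xExp_erase (n : Fin r → ℕ+) {τ : Finset V} {x : V} (hx : x ∈ τ) :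
    xExp n {x} + xExp n (τ.erase x) = xExp n τ := by
  rw [xExp, Finset.sum_singleton]
  exact Finset.add_sum_erase τ (fun v => Finsupp.single (Sum.inl v) 1) hx

variable [Fintype V]

/-- The multidegree of the pair `(I, ∅)`. -/
noncomputable def pairDegree (n : Fin r → ℕ+) (p : V → Fin r) (I : Finset V) :
    WhiskerVertex V n →₀ ℕ :=
  xExp n Iᶜ + wExp n p I

theorem wExp_add_pairDegree_erase (n : Fin r → ℕ+) (p : V → Fin r) {I : Finset V} {x : V}
    (hx : x ∈ I) :
    wExp n p {x} + pairDegree n p (I.erase x) = pairDegree n p I + xExp n {x} := by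
  rw [pairDegree, pairDegree, ← Finset.insert_erase hx, wExp_insert n p (Finset.notMem_erase x I),
    Finset.insert_erase hx]
  have : xExp n (I.erase x)ᶜ = xExp n Iᶜ + xExp n {x} := by
    rw [xExp, xExp, xExp, Finset.compl_erase, Finset.sum_insert (by simpa using hx),
      Finset.sum_singleton, add_comm]
  rw [this]
  abel

/-- The value of the contracting homotopy at the multidegree `M` of the polynomial ring itself. -/
noncomputable def pairSection (k : Type*) [Field k] (n : Fin r → ℕ+) (p : V → Fin r) :
    MvPolynomial (WhiskerVertex V n) k →ₗ[k] PairModule k V n :=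
  (basisMonomials (WhiskerVertex V n) k).constr k fun M =>
    Finsupp.single (Finset.univ.filter fun v => M (Sum.inl v) = 0, ∅)
      (monomial (M - pairDegree n p (Finset.univ.filter fun v => M (Sum.inl v) = 0)) 1)

/-- The walk from (I, ∅) ends at the set of vertices whose variable is absent from the total
monomial. This set depends only on that monomial, so the endpoint factors through the augmentation.
-/
theorem pairSection_monomial (k : Type*) [Field k] {n : Fin r → ℕ+} (p : V → Fin r)
    (I : Finset V) (e : WhiskerVertex V n →₀ ℕ) :
    pairSection k n p (monomial (e + pairDegree n p I) 1) =
      Finsupp.single (I \ freeAbove I ∅ e, ∅)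
        (exchange k p e (freeAbove I ∅ e) (freeAbove I ∅ e)) := by
  have h := (basisMonomials (WhiskerVertex V n) k).constr_basis k
    (fun M => (Finsupp.single (Finset.univ.filter fun v => M (Sum.inl v) = 0, ∅)
      (monomial (M - pairDegree n p (Finset.univ.filter fun v => M (Sum.inl v) = 0)) 1) :
        PairModule k V n)) (e + pairDegree n p I)
  rw [coe_basisMonomials] at h
  have hI : (Finset.univ.filter fun v => (e + pairDegree n p I) (Sum.inl v) = 0) =
      I \ freeAbove I ∅ e := by
    ext v
    simp only [pairDegree, Finset.mem_filter, Finset.mem_univ, Finsupp.add_apply, xExp_inl,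
      wExp_inl, Finset.mem_sdiff, mem_freeAbove, Finset.mem_compl]
    by_cases hv : v ∈ I <;> simp [hv]
  rw [pairSection, h, hI, exchange]
  congr 3
  have hsub : freeAbove I ∅ e ⊆ I := fun z hz => (mem_freeAbove.1 hz).1
  ext (v | w)
  · simp only [pairDegree, Finsupp.add_apply, Finsupp.tsub_apply, xExp_inl, wExp_inl,
      Finset.mem_sdiff, mem_freeAbove, Finset.mem_compl]
    by_cases hv : v ∈ I <;> by_cases he : e (Sum.inl v) = 0 <;> simp [hv, he]
  -- Splitting w_I along `freeAbove I ∅ e` makes the truncated subtraction exact at the whiskers.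
  · have := DFunLike.congr_fun (wExp_sdiff_add n p hsub) (Sum.inr w)
    simp only [pairDegree, Finsupp.add_apply, Finsupp.tsub_apply, xExp_inr] at this ⊢
    lia

theorem pairDifferential_pairHomotopy_empty (k : Type*) [Field k] {n : Fin r → ℕ+}
    (p : V → Fin r) (I : Finset V) (e : WhiskerVertex V n →₀ ℕ) :
    pairDifferential k n p (pairHomotopy k n p (Finsupp.single (I, ∅) (monomial e 1))) =
      Finsupp.single (I, ∅) (monomial e 1) -
        pairSection k n p (monomial (e + pairDegree n p I) 1) := by
  rw [pairHomotopy_single, pairDifferential_homotopyValue, pairSection_monomial,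
    Finset.sum_empty, add_zero]

end Degrees

/-! ### Minimal vertex covers and independent sets -/

section Covers

theorem injOn_index {V : Type*} {G : SimpleGraph V} {r : ℕ} (π : CliquePartition G r) {I : Finset V} (hI : G.IsIndepSet (I : Set V)) :
    Set.InjOn π.index (I : Set V) := by
  intro u hu v hv h
  by_contra hne
  exact hI hu hv hne (π.isClique (π.index v) h rfl hne)

variable {V : Type*} [Fintype V] [LinearOrder V] {G : SimpleGraph V} {r : ℕ}

/-- The set `(V(G) \ I) ∪ {w_{i,k} | I ∩ W_i ≠ ∅}`. -/
def coverOf (n : Fin r → ℕ+) (p : V → Fin r) (I : Finset V) : Finset (WhiskerVertex V n) :=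
  Iᶜ.image Sum.inl ∪ I.biUnion fun u => whiskers V n (p u)

@[simp]
theorem inl_mem_coverOf {n : Fin r → ℕ+} {p : V → Fin r} {I : Finset V} {v : V} :
    Sum.inl v ∈ coverOf n p I ↔ v ∉ I := by
  simp [coverOf, whiskers]

@[simp]
theorem inr_mem_coverOf {n : Fin r → ℕ+} {p : V → Fin r} {I : Finset V}
    {w : Σ i : Fin r, Fin (n i : ℕ)} :
    Sum.inr w ∈ coverOf n p I ↔ ∃ u ∈ I, p u = w.1 := by
  obtain ⟨i, j⟩ := w
  simp only [coverOf, whiskers, Finset.mem_union, Finset.mem_image, reduceCtorEq, and_false,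
    exists_false, false_or, Finset.mem_biUnion, Finset.mem_univ, true_and, Sum.inr.injEq]
  refine exists_congr fun u => and_congr_right fun _ => ⟨?_, ?_⟩
  · rintro ⟨a, h⟩
    exact congrArg Sigma.fst h
  · rintro rfl
    exact ⟨j, rfl⟩

@[simp]
theorem mem_uncovered {n : Fin r → ℕ+} {C : Finset (WhiskerVertex V n)} {v : V} :
    v ∈ uncovered C ↔ Sum.inl v ∉ C := by
  simp [uncovered]

theorem uncovered_coverOf (n : Fin r → ℕ+) (p : V → Fin r) (I : Finset V) :
    uncovered (coverOf n p I) = I := by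
  ext v
  simp

theorem uncovered_swapCover (π : CliquePartition G r) {n : Fin r → ℕ+}
    (C : Finset (WhiskerVertex V n)) (x : V) :
    uncovered (swapCover π C x) = (uncovered C).erase x := by
  ext v
  simp [swapCover, whiskers, and_comm]

/-- Distinct elements of I lie in distinct blocks, so the sets of whiskers united in `coverOf` are
disjoint and no whisker is counted twice in w_I. -/
theorem sum_coverOf (π : CliquePartition G r) (n : Fin r → ℕ+) {I : Finset V}
    (hI : G.IsIndepSet (I : Set V)) :
    ∑ v ∈ coverOf n π.index I, Finsupp.single v 1 = pairDegree n π.index I := by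
  rw [coverOf, Finset.sum_union, Finset.sum_image, Finset.sum_biUnion, pairDegree, xExp, wExp]
  · refine congrArg _ (Finset.sum_congr rfl fun u _ => ?_)
    rw [whiskers, Finset.sum_image]
    intro a _ b _ h
    simpa using h
  · intro u hu v hv huv
    refine Finset.disjoint_left.2 fun w hw hw' => huv (injOn_index π hI hu hv ?_)
    simp only [whiskers, Finset.mem_image, Finset.mem_univ, true_and] at hw hw'
    obtain ⟨a, rfl⟩ := hw
    obtain ⟨b, hb⟩ := hw'
    exact (congrArg Sigma.fst (Sum.inr.inj hb)).symm
  · exact Sum.inl_injective.injOn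
  · rw [Finset.disjoint_left]
    rintro (v | w) h h' <;> simp [whiskers] at h h'

theorem isMinimalVertexCover_coverOf (π : CliquePartition G r) (n : Fin r → ℕ+) {I : Finset V}
    (hI : G.IsIndepSet (I : Set V)) :
    IsMinimalVertexCover (multiCliqueWhiskered π n) (coverOf n π.index I) := by
  refine ⟨?_, fun D hD hDC a ha => ?_⟩
  · rintro (u | w) (v | w') h
    · simp only [Finset.mem_coe, inl_mem_coverOf]
      by_contra! hcon
      exact hI hcon.1 hcon.2 (G.ne_of_adj h) h
    · simp only [Finset.mem_coe, inl_mem_coverOf, inr_mem_coverOf]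
      by_contra! hcon
      exact hcon.2 u hcon.1 h
    · simp only [Finset.mem_coe, inl_mem_coverOf, inr_mem_coverOf]
      by_contra! hcon
      exact hcon.1 v hcon.2 h
    · exact h.elim
  · have hD' : ∀ u ∈ I, Sum.inl u ∉ D := fun u hu h => inl_mem_coverOf.1 (hDC h) hu
    rcases a with v | w
    · have hv : v ∉ I := inl_mem_coverOf.1 ha
      by_contra hvD
      have hw : Sum.inr ⟨π.index v, ⟨0, (n _).pos⟩⟩ ∈ D :=
        (hD (v := Sum.inl v) (w := Sum.inr ⟨π.index v, ⟨0, (n _).pos⟩⟩) rfl).resolve_left hvD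
      obtain ⟨u, hu, huv⟩ := inr_mem_coverOf.1 (hDC hw)
      -- The whisker of v belongs to the cover only because some u ∈ I shares the block of v; then
      -- the edge uv is missed by D.
      have hadj : G.Adj u v := π.isClique (π.index v) huv rfl fun h => hv (h ▸ hu)
      exact (hD (v := Sum.inl u) (w := Sum.inl v) hadj).elim (hD' u hu) hvD
    · obtain ⟨u, hu, huw⟩ := inr_mem_coverOf.1 ha
      exact (hD (v := Sum.inl u) (w := Sum.inr w) huw).resolve_left (hD' u hu)

theorem isIndepSet_uncovered (π : CliquePartition G r) {n : Fin r → ℕ+}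
    {C : Finset (WhiskerVertex V n)} (hC : IsMinimalVertexCover (multiCliqueWhiskered π n) C) :
    G.IsIndepSet (uncovered C : Set V) := by
  intro u hu v hv _ h
  exact (hC.prop (v := Sum.inl u) (w := Sum.inl v) h).elim (mem_uncovered.1 hu)
    (mem_uncovered.1 hv)

/-- By minimality, a whisker in C has a neighbour outside C, and all its neighbours are vertices of
its block. -/
theorem coverOf_uncovered (π : CliquePartition G r) {n : Fin r → ℕ+}
    {C : Finset (WhiskerVertex V n)} (hC : IsMinimalVertexCover (multiCliqueWhiskered π n) C) :
    coverOf n π.index (uncovered C) = C := by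
  ext (v | w)
  · simp
  · rw [inr_mem_coverOf]
    constructor
    · rintro ⟨u, hu, huw⟩
      exact (hC.prop (v := Sum.inl u) (w := Sum.inr w) huw).resolve_left (mem_uncovered.1 hu)
    · intro hw
      obtain ⟨u | w', hadj, hu⟩ := hC.exists_adj_notMem hw
      · exact ⟨u, mem_uncovered.2 hu, hadj⟩
      · exact hadj.elim

/-- The pairs `(I, τ)` of an independent set `I` of `G` and a subset `τ` of `I` with `i`
elements. -/
def indepPairs (G : SimpleGraph V) (i : ℕ) : Set (Finset V × Finset V) :=
  {b | G.IsIndepSet (b.1 : Set V) ∧ b.2 ⊆ b.1 ∧ b.2.card = i}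

namespace ResolutionSymbol

/-- The symbols `f(C; τ)` correspond to the pairs `(V(G) \ C, τ)`. -/
def equivPairs (π : CliquePartition G r) (n : Fin r → ℕ+) (i : ℕ) :
    ResolutionSymbol π n i ≃ indepPairs G i where
  toFun b := ⟨(uncovered b.cover, b.sub), isIndepSet_uncovered π b.isMinimal,
    Finset.mem_powersetCard.1 b.mem_powersetCard⟩
  invFun b := ⟨coverOf n π.index b.1.1, isMinimalVertexCover_coverOf π n b.2.1, b.1.2,
    Finset.mem_powersetCard.2 ⟨by rw [uncovered_coverOf]; exact b.2.2.1, b.2.2.2⟩⟩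
  left_inv b := by
    cases b with
    | mk C hC τ h => simp only [coverOf_uncovered π hC]
  right_inv b := Subtype.ext (Prod.ext (uncovered_coverOf n π.index b.1.1) rfl)

/-- The pair `(V(G) \ C, τ)` of the symbol `f(C; τ)`. -/
def toPair {π : CliquePartition G r} {n : Fin r → ℕ+} {i : ℕ} (b : ResolutionSymbol π n i) :
    Finset V × Finset V :=
  (equivPairs π n i b).1

theorem toPair_injective (π : CliquePartition G r) (n : Fin r → ℕ+) (i : ℕ) :
    Function.Injective (toPair : ResolutionSymbol π n i → Finset V × Finset V) :=
  Subtype.val_injective.comp (equivPairs π n i).injective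

theorem exists_toPair_eq (π : CliquePartition G r) (n : Fin r → ℕ+) {i : ℕ}
    {b : Finset V × Finset V} (hb : b ∈ indepPairs G i) :
    ∃ c : ResolutionSymbol π n i, c.toPair = b :=
  ⟨(equivPairs π n i).symm ⟨b, hb⟩, by simp [toPair]⟩

theorem toPair_mem {π : CliquePartition G r} {n : Fin r → ℕ+} {i : ℕ}
    (b : ResolutionSymbol π n i) : b.toPair ∈ indepPairs G i :=
  (equivPairs π n i b).2

theorem toPair_erase {π : CliquePartition G r} {n : Fin r → ℕ+} {i : ℕ}
    (b : ResolutionSymbol π n (i + 1)) (x : V) (hx : x ∈ b.sub) :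
    (b.erase x hx).toPair = (b.toPair.1, b.toPair.2.erase x) :=
  rfl

theorem toPair_swap {π : CliquePartition G r} {n : Fin r → ℕ+} {i : ℕ}
    (b : ResolutionSymbol π n (i + 1)) (x : V) (hx : x ∈ b.sub) :
    (b.swap x hx).toPair = (b.toPair.1.erase x, b.toPair.2.erase x) :=
  Prod.ext (uncovered_swapCover π b.cover x) rfl

instance (π : CliquePartition G r) (n : Fin r → ℕ+) (i : ℕ) : Finite (ResolutionSymbol π n i) :=
  Finite.of_injective _ (toPair_injective π n i)

theorem sum_cover {π : CliquePartition G r} {n : Fin r → ℕ+} {i : ℕ}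
    (b : ResolutionSymbol π n i) :
    ∑ v ∈ b.cover, Finsupp.single v 1 = pairDegree n π.index b.toPair.1 := by
  rw [← sum_coverOf π n b.toPair_mem.1]
  exact congrArg (fun C => ∑ v ∈ C, Finsupp.single v 1) (coverOf_uncovered π b.isMinimal).symm

theorem prod_cover (k : Type*) [Field k] {π : CliquePartition G r} {n : Fin r → ℕ+} {i : ℕ}
    (b : ResolutionSymbol π n i) :
    ∏ v ∈ b.cover, X v = monomial (pairDegree n π.index b.toPair.1) (1 : k) := by
  rw [← b.sum_cover, monomial_sum_one]
  rfl

end ResolutionSymbol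

end Covers

/-! ### Induction over monomial multiples of basis elements -/

section Induction

/-- Serves identities between maps that are only k-linear, such as those involving the homotopy. -/
theorem Finsupp.induction_monomial {k σ B : Type*} [Field k] {P : (B →₀ MvPolynomial σ k) → Prop}
    (zero : P 0) (add : ∀ x y, P x → P y → P (x + y)) (smul : ∀ (c : k) x, P x → P (c • x))
    (single : ∀ b e, P (Finsupp.single b (monomial e 1))) (x : B →₀ MvPolynomial σ k) : P x := by
  induction x using Finsupp.induction_linear with
  | zero => exact zero
  | add x y hx hy => exact add x y hx hy
  | single b q =>
    induction q using MvPolynomial.induction_on' with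
    | monomial e c =>
      have h := smul c _ (single b e)
      rwa [Finsupp.smul_single, smul_monomial, smul_eq_mul, mul_one] at h
    | add p q hp hq => rw [Finsupp.single_add]; exact add _ _ hp hq

end Induction
-- Multihomogeneous elements of free modules
section Multihomogeneous

variable {k σ B B' : Type*} [Field k]

theorem isMultihomogeneous_zero (deg : B → (σ →₀ ℕ)) (m : σ →₀ ℕ) :
    IsMultihomogeneous deg m (0 : B →₀ MvPolynomial σ k) := by
  intro b e he
  simp at he

theorem IsMultihomogeneous.add {deg : B → (σ →₀ ℕ)} {m : σ →₀ ℕ} {x y : B →₀ MvPolynomial σ k}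
    (hx : IsMultihomogeneous deg m x) (hy : IsMultihomogeneous deg m y) :
    IsMultihomogeneous deg m (x + y) := by
  classical
  intro b e he
  exact (Finset.mem_union.1 (support_add he)).elim (hx b e) (hy b e)

theorem IsMultihomogeneous.neg {deg : B → (σ →₀ ℕ)} {m : σ →₀ ℕ} {x : B →₀ MvPolynomial σ k}
    (hx : IsMultihomogeneous deg m x) : IsMultihomogeneous deg m (-x) := by
  intro b e he
  rw [Finsupp.neg_apply, support_neg] at he
  exact hx b e he

theorem IsMultihomogeneous.sum {α : Type*} {deg : B → (σ →₀ ℕ)} {m : σ →₀ ℕ} {s : Finset α}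
    {f : α → B →₀ MvPolynomial σ k} (h : ∀ a ∈ s, IsMultihomogeneous deg m (f a)) :
    IsMultihomogeneous deg m (∑ a ∈ s, f a) :=
  Finset.sum_induction f _ (fun _ _ => IsMultihomogeneous.add) (isMultihomogeneous_zero deg m) h

theorem IsMultihomogeneous.smul {deg : B → (σ →₀ ℕ)} {m m' : σ →₀ ℕ}
    {x : B →₀ MvPolynomial σ k} (hx : IsMultihomogeneous deg m' x) {q : MvPolynomial σ k}
    (hq : ∀ e ∈ q.support, e + m' = m) : IsMultihomogeneous deg m (q • x) := by
  classical
  intro b e he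
  rw [Finsupp.smul_apply, smul_eq_mul] at he
  obtain ⟨e₁, h₁, e₂, h₂, rfl⟩ := Finset.mem_add.1 (support_mul _ _ he)
  rw [add_assoc, hx b e₂ h₂, hq e₁ h₁]

theorem isMultihomogeneous_single_monomial {deg : B → (σ →₀ ℕ)} {m e : σ →₀ ℕ} {b : B}
    (h : e + deg b = m) : IsMultihomogeneous deg m (Finsupp.single b (monomial e (1 : k))) := by
  classical
  intro c e' he'
  rw [Finsupp.single_apply] at he'
  split_ifs at he' with hc
  · subst hc
    rw [support_monomial, if_neg one_ne_zero, Finset.mem_singleton] at he'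
    rwa [he']
  · simp at he'

theorem IsMultihomogeneous.linearCombination {deg : B → (σ →₀ ℕ)} {deg' : B' → (σ →₀ ℕ)}
    {f : B → B' →₀ MvPolynomial σ k} (hf : ∀ b, IsMultihomogeneous deg' (deg b) (f b))
    {m : σ →₀ ℕ} {x : B →₀ MvPolynomial σ k} (hx : IsMultihomogeneous deg m x) :
    IsMultihomogeneous deg' m (Finsupp.linearCombination (MvPolynomial σ k) f x) := by
  rw [Finsupp.linearCombination_apply, Finsupp.sum]
  exact IsMultihomogeneous.sum fun b _ => (hf b).smul (hx b)

end Multihomogeneous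

/-! ### Homogeneity, surjectivity of the augmentation and minimality -/

section Resolution

variable {k : Type*} [Field k] {V : Type*} [Fintype V] [LinearOrder V] {G : SimpleGraph V} {r : ℕ}
  (π : CliquePartition G r) (n : Fin r → ℕ+)

open ResolutionSymbol

theorem coverSequence_deg (i : ℕ) (b : ResolutionSymbol π n i) :
    (coverSequence k π n).deg i b = pairDegree n π.index b.toPair.1 + xExp n b.toPair.2 :=
  congrArg (· + xExp n b.sub) b.sum_cover

theorem coverDifferential_homogeneous (i : ℕ) (m : WhiskerVertex V n →₀ ℕ)
    (x : ResolutionSymbol π n (i + 1) →₀ MvPolynomial (WhiskerVertex V n) k)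
    (hx : IsMultihomogeneous ((coverSequence k π n).deg (i + 1)) m x) :
    IsMultihomogeneous ((coverSequence k π n).deg i) m (coverDifferential k π n i x) := by
  refine IsMultihomogeneous.linearCombination (fun b => ?_) hx
  refine IsMultihomogeneous.sum fun x _ => ?_
  have hsub : x.1 ∈ b.toPair.2 := x.2
  have hI : x.1 ∈ b.toPair.1 := b.toPair_mem.2.1 hsub
  have h : IsMultihomogeneous ((coverSequence k π n).deg i) ((coverSequence k π n).deg (i + 1) b)
      (Finsupp.single (b.swap x.1 x.2) (wProd k V n (π.index x.1)) -
        Finsupp.single (b.erase x.1 x.2) (xVar k n x.1)) := by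
    rw [← monomial_wExp_singleton, ← monomial_xExp_singleton, sub_eq_add_neg]
    refine (isMultihomogeneous_single_monomial ?_).add
      (isMultihomogeneous_single_monomial ?_).neg
    · rw [coverSequence_deg, coverSequence_deg, toPair_swap, ← add_assoc,
        wExp_add_pairDegree_erase n π.index hI, add_assoc, xExp_add_xExp_erase n hsub]
    · rw [coverSequence_deg, coverSequence_deg, toPair_erase, add_left_comm,
        xExp_add_xExp_erase n hsub]
  rcases neg_one_pow_eq_or (MvPolynomial (WhiskerVertex V n) k)
    (b.sub.filter fun y => x.1 < y).card with h1 | h1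
  · rwa [h1, one_smul]
  · rw [h1, neg_one_smul]
    exact h.neg

theorem coverAugmentation_single (b : ResolutionSymbol π n 0)
    (q : MvPolynomial (WhiskerVertex V n) k) :
    (coverAugmentation k π n (Finsupp.single b q) : MvPolynomial (WhiskerVertex V n) k) =
      q * monomial (pairDegree n π.index b.toPair.1) 1 := by
  rw [coverAugmentation, Finsupp.linearCombination_single, Submodule.coe_smul, smul_eq_mul]
  exact congrArg (q * ·) (b.prod_cover k)

theorem coverAugmentation_homogeneous (m : WhiskerVertex V n →₀ ℕ)
    (x : ResolutionSymbol π n 0 →₀ MvPolynomial (WhiskerVertex V n) k)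
    (hx : IsMultihomogeneous ((coverSequence k π n).deg 0) m x) :
    ∀ e ∈ (coverAugmentation k π n x : MvPolynomial (WhiskerVertex V n) k).support, e = m := by
  classical
  intro e he
  rw [← x.sum_single, Finsupp.sum, map_sum, AddSubmonoidClass.coe_finsetSum] at he
  obtain ⟨b, -, hb⟩ := Finset.mem_biUnion.1 (support_sum he)
  rw [coverAugmentation_single] at hb
  obtain ⟨e₁, h₁, e₂, h₂, rfl⟩ := Finset.mem_add.1 (support_mul _ _ hb)
  rw [support_monomial, if_neg one_ne_zero, Finset.mem_singleton] at h₂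
  have hempty : b.toPair.2 = ∅ := Finset.card_eq_zero.1 b.toPair_mem.2.2
  rw [h₂, ← hx b e₁ h₁, coverSequence_deg, hempty]
  simp [xExp]

theorem coverAugmentation_surjective : Function.Surjective (coverAugmentation k π n) := by
  have hle : coverIdeal k (multiCliqueWhiskered π n) ≤
      LinearMap.range ((coverIdeal k (multiCliqueWhiskered π n)).subtype ∘ₗ
        coverAugmentation k π n) := by
    refine Ideal.span_le.2 ?_
    rintro _ ⟨C, hC, rfl⟩
    -- Every cover contains a minimal one, whose monomial divides that of the cover.
    obtain ⟨D, hDC, hD⟩ := exists_minimal_le_of_wellFoundedLT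
      (fun D : Finset (WhiskerVertex V n) =>
        (multiCliqueWhiskered π n).IsVertexCover (D : Set (WhiskerVertex V n))) C hC
    refine ⟨Finsupp.single ⟨D, hD, ∅, by simp⟩ (∏ v ∈ C \ D, X v), ?_⟩
    rw [LinearMap.comp_apply, coverAugmentation, Finsupp.linearCombination_single,
      Submodule.subtype_apply, Submodule.coe_smul, smul_eq_mul, Finset.prod_sdiff hDC]
  rintro ⟨q, hq⟩
  obtain ⟨x, hx⟩ := hle hq
  exact ⟨x, Subtype.ext hx⟩

theorem single_mem_smul_top {S B : Type*} [CommRing S] {I : Ideal S} {q : S} (hq : q ∈ I) (b : B) :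
    Finsupp.single b q ∈ I • (⊤ : Submodule S (B →₀ S)) := by
  rw [← mul_one q, ← smul_eq_mul, ← Finsupp.smul_single]
  exact Submodule.smul_mem_smul hq trivial

theorem coverDifferential_minimal (i : ℕ)
    (x : ResolutionSymbol π n (i + 1) →₀ MvPolynomial (WhiskerVertex V n) k) :
    coverDifferential k π n i x ∈ Ideal.span (Set.range
      (X : WhiskerVertex V n → MvPolynomial (WhiskerVertex V n) k)) •
        (⊤ : Submodule (MvPolynomial (WhiskerVertex V n) k)
          (ResolutionSymbol π n i →₀ MvPolynomial (WhiskerVertex V n) k)) := by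
  have hX : ∀ v : WhiskerVertex V n, (X v : MvPolynomial (WhiskerVertex V n) k) ∈
      Ideal.span (Set.range (X : WhiskerVertex V n → MvPolynomial (WhiskerVertex V n) k)) :=
    fun v => Ideal.subset_span ⟨v, rfl⟩
  rw [coverDifferential, Finsupp.linearCombination_apply]
  refine Submodule.sum_mem _ fun b _ => Submodule.smul_mem _ _ <|
    Submodule.sum_mem _ fun x _ => Submodule.smul_mem _ _ <|
      Submodule.sub_mem _ (single_mem_smul_top ?_ _) (single_mem_smul_top (hX _) _)
  -- As n_i is positive, the product w_i has a first factor and is not the empty product 1.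
  exact Ideal.mem_of_dvd _ (Finset.dvd_prod_of_mem _ (Finset.mem_univ ⟨0, (n _).pos⟩)) (hX _)

/-! ### Exactness, carried over from the module on all pairs -/

/-- The embedding of the `i`-th free module into the free module on all pairs. -/
noncomputable def pairEmbedding (k : Type*) [Field k] (i : ℕ) :
    (ResolutionSymbol π n i →₀ MvPolynomial (WhiskerVertex V n) k)
      →ₗ[MvPolynomial (WhiskerVertex V n) k] PairModule k V n :=
  Finsupp.lmapDomain _ _ toPair

theorem pairEmbedding_single (i : ℕ) (b : ResolutionSymbol π n i)
    (q : MvPolynomial (WhiskerVertex V n) k) :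
    pairEmbedding π n k i (Finsupp.single b q) = Finsupp.single b.toPair q :=
  Finsupp.mapDomain_single

theorem pairEmbedding_injective (i : ℕ) : Function.Injective (pairEmbedding π n k i) :=
  Finsupp.mapDomain_injective (toPair_injective π n i)

theorem pairEmbedding_apply (i : ℕ)
    (x : ResolutionSymbol π n i →₀ MvPolynomial (WhiskerVertex V n) k)
    (b : ResolutionSymbol π n i) : pairEmbedding π n k i x b.toPair = x b :=
  Finsupp.mapDomain_apply (toPair_injective π n i) x b

theorem single_mem_range_pairEmbedding {i : ℕ} {b : Finset V × Finset V} (hb : b ∈ indepPairs G i)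
    (q : MvPolynomial (WhiskerVertex V n) k) :
    Finsupp.single b q ∈ LinearMap.range (pairEmbedding π n k i) := by
  obtain ⟨c, rfl⟩ := exists_toPair_eq π n hb
  exact ⟨Finsupp.single c q, pairEmbedding_single π n i c q⟩

theorem pairEmbedding_coverDifferential (i : ℕ)
    (x : ResolutionSymbol π n (i + 1) →₀ MvPolynomial (WhiskerVertex V n) k) :
    pairEmbedding π n k i (coverDifferential k π n i x) =
      pairDifferential k n π.index (pairEmbedding π n k (i + 1) x) := by
  have key : pairEmbedding π n k i ∘ₗ coverDifferential k π n i =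
      pairDifferential k n π.index ∘ₗ pairEmbedding π n k (i + 1) := by
    refine Finsupp.lhom_ext' fun b => LinearMap.ext_ring ?_
    simp only [LinearMap.comp_apply, Finsupp.lsingle_apply]
    rw [pairEmbedding_single, coverDifferential, Finsupp.linearCombination_single, one_smul,
      map_sum, ← Prod.mk.eta (p := b.toPair), pairDifferential_single,
      ← Finset.sum_attach b.toPair.2]
    refine Finset.sum_congr rfl fun x _ => ?_
    rw [map_smul, map_sub, pairEmbedding_single, pairEmbedding_single, toPair_swap, toPair_erase,
      one_smul]
    rfl
  exact LinearMap.congr_fun key x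

/-- The homotopy only shrinks I, which keeps it independent. It removes elements strictly above x,
hence neither x nor elements of τ. -/
theorem pairHomotopy_pairEmbedding_mem_range (i : ℕ)
    (x : ResolutionSymbol π n i →₀ MvPolynomial (WhiskerVertex V n) k) :
    pairHomotopy k n π.index (pairEmbedding π n k i x) ∈
      LinearMap.range (pairEmbedding π n k (i + 1)) := by
  induction x using Finsupp.induction_monomial with
  | zero => simp
  | add x y hx hy => rw [map_add, map_add]; exact Submodule.add_mem _ hx hy
  | smul c x hx =>
    rw [LinearMap.map_smul_of_tower, map_smul]
    exact Submodule.smul_of_tower_mem _ c hx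
  | single b e =>
    rw [pairEmbedding_single, ← Prod.mk.eta (p := b.toPair), pairHomotopy_single, homotopyValue]
    refine Submodule.neg_mem _ (Submodule.sum_mem _ fun x hx => ?_)
    obtain ⟨hxI, -, hx⟩ := mem_freeAbove.1 hx
    obtain ⟨hI, hτ, hcard⟩ := b.toPair_mem
    refine single_mem_range_pairEmbedding π n ⟨?_, ?_, ?_⟩ _
    · exact hI.mono (by simp)
    · refine Finset.insert_subset (by simp [hxI]) fun y hy => ?_
      simp [hτ hy, (hx y hy).le]
    · rw [Finset.card_insert_of_notMem fun h => lt_irrefl x (hx x h), hcard]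

theorem pairDifferential_add_pairHomotopy_pairEmbedding (i : ℕ)
    (x : ResolutionSymbol π n (i + 1) →₀ MvPolynomial (WhiskerVertex V n) k) :
    pairDifferential k n π.index (pairHomotopy k n π.index (pairEmbedding π n k (i + 1) x)) +
      pairHomotopy k n π.index (pairDifferential k n π.index (pairEmbedding π n k (i + 1) x)) =
    pairEmbedding π n k (i + 1) x := by
  induction x using Finsupp.induction_monomial with
  | zero => simp
  | add x y hx hy =>
    simp only [map_add]
    rw [add_add_add_comm, hx, hy]
  | smul c x hx =>
    simp only [LinearMap.map_smul_of_tower]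
    rw [← smul_add, hx]
  | single b e =>
    obtain ⟨-, hτ, hcard⟩ := b.toPair_mem
    rw [pairEmbedding_single]
    exact pairDifferential_add_pairHomotopy k π.index hτ
      (Finset.card_pos.1 (by lia)) e

theorem pairDifferential_pairHomotopy_pairEmbedding
    (x : ResolutionSymbol π n 0 →₀ MvPolynomial (WhiskerVertex V n) k) :
    pairDifferential k n π.index (pairHomotopy k n π.index (pairEmbedding π n k 0 x)) +
      pairSection k n π.index (coverAugmentation k π n x : MvPolynomial (WhiskerVertex V n) k) =
    pairEmbedding π n k 0 x := by
  induction x using Finsupp.induction_monomial with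
  | zero => simp
  | add x y hx hy =>
    simp only [map_add, Submodule.coe_add]
    rw [add_add_add_comm, hx, hy]
  | smul c x hx =>
    simp only [LinearMap.map_smul_of_tower, Submodule.coe_smul_of_tower]
    rw [← smul_add, hx]
  | single b e =>
    have hempty : b.toPair.2 = ∅ := Finset.card_eq_zero.1 b.toPair_mem.2.2
    rw [pairEmbedding_single, coverAugmentation_single, monomial_mul, one_mul,
      ← Prod.mk.eta (p := b.toPair), hempty, pairDifferential_pairHomotopy_empty, sub_add_cancel]

/-- Both terms of each face are mapped to the same monomial. -/
theorem coverAugmentation_coverDifferential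
    (x : ResolutionSymbol π n 1 →₀ MvPolynomial (WhiskerVertex V n) k) :
    coverAugmentation k π n (coverDifferential k π n 0 x) = 0 := by
  have key : coverAugmentation k π n ∘ₗ coverDifferential k π n 0 = 0 := by
    refine Finsupp.lhom_ext' fun b => LinearMap.ext_ring ?_
    simp only [LinearMap.comp_apply, Finsupp.lsingle_apply, LinearMap.zero_apply]
    rw [coverDifferential, Finsupp.linearCombination_single, one_smul, map_sum]
    refine Finset.sum_eq_zero fun x _ => ?_
    have hI : x.1 ∈ b.toPair.1 := b.toPair_mem.2.1 x.2
    rw [map_smul, map_sub, sub_eq_zero.2 (Subtype.ext ?_), smul_zero]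
    rw [coverAugmentation_single, coverAugmentation_single, toPair_swap, toPair_erase,
      ← monomial_wExp_singleton, ← monomial_xExp_singleton, monomial_mul, monomial_mul,
      wExp_add_pairDegree_erase n π.index hI, add_comm]
  exact LinearMap.congr_fun key x

theorem coverDifferential_comp_self (i : ℕ)
    (x : ResolutionSymbol π n (i + 2) →₀ MvPolynomial (WhiskerVertex V n) k) :
    coverDifferential k π n i (coverDifferential k π n (i + 1) x) = 0 := by
  apply pairEmbedding_injective π n i
  rw [pairEmbedding_coverDifferential, pairEmbedding_coverDifferential, pairDifferential_comp_self,
    map_zero]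

/-- An element of the image of the contracting homotopy bounds. -/
theorem mem_range_coverDifferential {i : ℕ}
    {x : ResolutionSymbol π n i →₀ MvPolynomial (WhiskerVertex V n) k}
    (hx : pairDifferential k n π.index (pairHomotopy k n π.index (pairEmbedding π n k i x)) =
      pairEmbedding π n k i x) : x ∈ Set.range (coverDifferential k π n i) := by
  obtain ⟨y, hy⟩ := pairHomotopy_pairEmbedding_mem_range π n i x
  refine ⟨y, pairEmbedding_injective π n i ?_⟩
  rw [pairEmbedding_coverDifferential, hy, hx]

theorem coverDifferential_exact_zero :
    Function.Exact (coverDifferential k π n 0) (coverAugmentation k π n) := by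
  refine fun x => ⟨fun hx => mem_range_coverDifferential π n ?_, ?_⟩
  · have h := pairDifferential_pairHomotopy_pairEmbedding π n x
    rwa [hx, Submodule.coe_zero, map_zero, add_zero] at h
  · rintro ⟨y, rfl⟩
    exact coverAugmentation_coverDifferential π n y

theorem coverDifferential_exact_succ (i : ℕ) :
    Function.Exact (coverDifferential k π n (i + 1)) (coverDifferential k π n i) := by
  refine fun x => ⟨fun hx => mem_range_coverDifferential π n ?_, ?_⟩
  · have h := pairDifferential_add_pairHomotopy_pairEmbedding π n i x
    rwa [← pairEmbedding_coverDifferential, hx, map_zero, map_zero, add_zero] at h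
  · rintro ⟨y, rfl⟩
    exact coverDifferential_comp_self π n i y

theorem coverSequence_isMinimalFreeResolution :
    (coverSequence k π n).IsMinimalFreeResolution where
  finite i := inferInstanceAs (Finite (ResolutionSymbol π n i))
  aug_surjective := coverAugmentation_surjective π n
  exact_zero := coverDifferential_exact_zero π n
  exact_succ := coverDifferential_exact_succ π n
  aug_homogeneous := coverAugmentation_homogeneous π n
  d_homogeneous := coverDifferential_homogeneous π n
  minimal := coverDifferential_minimal π n

end Resolution

/-! ### Substituting products of whiskers -/

section Substitution

variable {k : Type*} [Field k] {V : Type*} {r : ℕ} (n : Fin r → ℕ+)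

theorem whiskerSubstitution_xVar (x : V) :
    whiskerSubstitution k V n (xVar k (fun _ => 1) x) = xVar k n x := by
  rw [whiskerSubstitution, xVar, aeval_X, Sum.elim_inl]

theorem whiskerSubstitution_wProd (i : Fin r) :
    whiskerSubstitution k V n (wProd k V (fun _ => 1) i) = wProd k V n i := by
  rw [wProd, map_prod]
  simp only [whiskerSubstitution, aeval_X, Sum.elim_inr]
  exact Fin.prod_univ_one _

variable [LinearOrder V]

theorem pairDifferential_substitution (p : V → Fin r) (b c : Finset V × Finset V) :
    pairDifferential k n p (Finsupp.single b 1) c = whiskerSubstitution k V n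
      (pairDifferential k (fun _ => 1) p (Finsupp.single b 1) c) := by
  obtain ⟨I, τ⟩ := b
  simp only [pairDifferential_single, one_smul, Finsupp.finsetSum_apply, map_sum,
    Finsupp.smul_apply, smul_eq_mul, map_mul, map_pow, map_neg, map_one]
  refine Finset.sum_congr rfl fun x _ => ?_
  congr 1
  simp only [pairFace, Finsupp.sub_apply, map_sub, Finsupp.single_apply]
  congr 1 <;> split_ifs <;> simp only [whiskerSubstitution_xVar, whiskerSubstitution_wProd, map_zero]

variable [Fintype V]

theorem whiskerSubstitution_monomial (p : V → Fin r) (I τ : Finset V) :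
    whiskerSubstitution k V n (monomial (pairDegree (fun _ => 1) p I + xExp (fun _ => 1) τ) 1) =
      monomial (pairDegree n p I + xExp n τ) 1 := by
  -- In product form the monomial involves only factors on which the substitution is already known.
  have h : ∀ m : Fin r → ℕ+, (monomial (pairDegree m p I + xExp m τ) (1 : k)) =
      (∏ x ∈ Iᶜ, xVar k m x) * (∏ x ∈ I, wProd k V m (p x)) * ∏ x ∈ τ, xVar k m x := by
    intro m
    rw [← monomial_xExp, ← monomial_xExp, ← monomial_wExp, monomial_mul, monomial_mul, one_mul,
      one_mul, pairDegree]
  rw [h, h]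
  simp only [map_mul, map_prod, whiskerSubstitution_xVar, whiskerSubstitution_wProd]

namespace ResolutionSymbol

variable {G : SimpleGraph V} (π : CliquePartition G r)

/-- The bijection between the symbols of the clique-whiskered graph and those of the
multi-clique-whiskered graph. -/
def whiskerEquiv (i : ℕ) : ResolutionSymbol π (fun _ => 1) i ≃ ResolutionSymbol π n i :=
  (equivPairs π (fun _ => 1) i).trans (equivPairs π n i).symm

theorem toPair_whiskerEquiv {i : ℕ} (b : ResolutionSymbol π (fun _ => 1) i) :
    (whiskerEquiv n π i b).toPair = b.toPair := by
  simp [whiskerEquiv, toPair]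

/-- Matrix entries can be read off in the module on all pairs, where corresponding symbols have the
same pair. -/
theorem coverDifferential_substitution (i : ℕ) (b : ResolutionSymbol π (fun _ => 1) (i + 1))
    (c : ResolutionSymbol π (fun _ => 1) i) :
    coverDifferential k π n i (Finsupp.single (whiskerEquiv n π (i + 1) b) 1)
        (whiskerEquiv n π i c) =
      whiskerSubstitution k V n
        (coverDifferential k π (fun _ => 1) i (Finsupp.single b 1) c) := by
  rw [← pairEmbedding_apply, ← pairEmbedding_apply, pairEmbedding_coverDifferential,
    pairEmbedding_coverDifferential, pairEmbedding_single, pairEmbedding_single,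
    toPair_whiskerEquiv, toPair_whiskerEquiv, pairDifferential_substitution]

theorem coverAugmentation_substitution (b : ResolutionSymbol π (fun _ => 1) 0) :
    (coverAugmentation k π n (Finsupp.single (whiskerEquiv n π 0 b) 1) :
        MvPolynomial (WhiskerVertex V n) k) =
      whiskerSubstitution k V n (coverAugmentation k π (fun _ => 1) (Finsupp.single b 1) :
        MvPolynomial (WhiskerVertex V fun _ : Fin r => 1) k) := by
  rw [coverAugmentation_single, coverAugmentation_single, one_mul, one_mul, toPair_whiskerEquiv]
  simpa [xExp] using (whiskerSubstitution_monomial (k := k) n π.index b.toPair.1 ∅).symm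

theorem deg_substitution (i : ℕ) (b : ResolutionSymbol π (fun _ => 1) i) :
    monomial ((coverSequence k π n).deg i (whiskerEquiv n π i b)) (1 : k) =
      whiskerSubstitution k V n (monomial ((coverSequence k π (fun _ => 1)).deg i b) 1) := by
  rw [coverSequence_deg, coverSequence_deg, whiskerSubstitution_monomial, toPair_whiskerEquiv]

theorem isSubstitution_whiskerEquiv :
    AugmentedFreeSequence.IsSubstitution (whiskerSubstitution k V n)
      (coverSequence k π (fun _ => 1)) (coverSequence k π n) (whiskerEquiv n π) where
  d_eq := coverDifferential_substitution n π
  aug_eq := coverAugmentation_substitution n π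
  deg_eq := deg_substitution n π

end ResolutionSymbol

end Substitution

theorem mainTheorem2 (k : Type*) [Field k] {V : Type*} [Fintype V] [LinearOrder V]
    (G : SimpleGraph V) {r : ℕ} (π : CliquePartition G r) (n : Fin r → ℕ+) :
    (coverSequence k π n).IsMinimalFreeResolution ∧
    ∃ e : ∀ i, ResolutionSymbol π (fun _ => 1) i ≃ ResolutionSymbol π n i,
      (∀ i b, (e i b).sub = b.sub) ∧
      (∀ i b v, Sum.inl v ∈ (e i b).cover ↔ Sum.inl v ∈ b.cover) ∧
      (∀ i b (j : Fin r) l l', Sum.inr ⟨j, l⟩ ∈ (e i b).cover ↔ Sum.inr ⟨j, l'⟩ ∈ b.cover) ∧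
      AugmentedFreeSequence.IsSubstitution (whiskerSubstitution k V n)
        (coverSequence k π (fun _ => 1)) (coverSequence k π n) e := by
  refine ⟨coverSequence_isMinimalFreeResolution π n, ResolutionSymbol.whiskerEquiv n π,
    fun i b => rfl, fun i b v => ?_, fun i b j l l' => ?_,
    ResolutionSymbol.isSubstitution_whiskerEquiv n π⟩
  · exact inl_mem_coverOf.trans (by simp [ResolutionSymbol.equivPairs])
  · refine inr_mem_coverOf.trans ?_
    -- Whether a whisker lies in the cover depends only on its block j, so neither n nor the
    -- positions l and l' matter.
    rw [← inr_mem_coverOf (n := fun _ => 1) (w := ⟨j, l'⟩)]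
    exact iff_of_eq (congrArg (Sum.inr ⟨j, l'⟩ ∈ ·) (coverOf_uncovered π b.isMinimal))
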